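/- Let $I,J\ge 1$, temperatures $w_1,\dots,w_I>0$ and inspection times $t_1,\dots,t_J>0$ be fixed, and let $\Theta=(0,\infty)\times\mathbb R$. For $\alpha=(\alpha_0,\alpha_1)\in\Theta$ put $\lambda_w(\alpha)=\alpha_0e^{\alpha_1w}$, $F_{ij}(\alpha)=1-e^{-\lambda_{w_i}(\alpha)t_j}$ and $f_{ij}(\alpha)=\lambda_{w_i}(\alpha)e^{-\lambda_{w_i}(\alpha)t_j}$. In the one-shot device model with $K\ge 1$ devices per test condition $(i,j)$, the observations $y_{ijk}\in\{0,1\}$ ($i\le I$, $j\le J$, $k\le K$) are independent with $y_{ijk}\sim\mathrm{Ber}(F_{ij}(\alpha))$. Write $n_{ij}=\sum_{k}y_{ijk}$, let $\mathcal L(\alpha)=\prod_{i,j}F_{ij}(\alpha)^{n_{ij}}(1-F_{ij}(\alpha))^{K-n_{ij}}$ be the likelihood, and let $\hat p$ and $p(\alpha)$ be the probability vectors of dimension $2IJ$ with entries $\frac{n_{ij}}{IJK},\frac{K-n_{ij}}{IJK}$ and $\frac{F_{ij}(\alpha)}{IJ},\frac{1-F_{ij}(\alpha)}{IJ}$. For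 $\beta>0$ let $d_\beta(p,q)=\sum_m\{q_m^{\beta+1}-(1+\frac1\beta)q_m^\beta p_m+\frac1\beta p_m^{1+\beta}\}$ and $d_0=\lim_{\beta\to0^+}d_\beta$. A minimum density power divergence estimate (MDPDE) with $\beta>0$ is a minimizer over $\Theta$ of $H_\beta(\alpha)=\frac1{IJK}\sum_{i,j,k}\{F_{ij}^{\beta+1}+(1-F_{ij})^{\beta+1}-\frac{1+\beta}\beta(F_{ij}^{y_{ijk}}(1-F_{ij})^{1-y_{ijk}})^\beta\}$; with $\beta=0$ it is a minimizer over $\Theta$ of $\alpha\mapsto d_0(\hat p,p(\alpha))$. Let $u_{ij}=\nabla_\alpha\log F_{ij}$, $v_{ij}=\nabla_\alpha\log(1-F_{ij})$, $\xi_{ij,\beta}=F_{ij}^{\beta+1}u_{ij}+(1-F_{ij})^{\beta+1}v_{ij}$ and $$J_\beta=\frac1{IJ}\sum_{i,j}\{F_{ij}^{\beta+1}u_{ij}u_{ij}^T+(1-F_{ij})^{\beta+1}v_{ij}v_{ij}^T\},$$ $$K_\beta=\frac1{IJ}\sum_{i,j}\{F_{ij}^{2\beta+1}u_{ij}u_{ij}^T+(1-F_{ij})^{2\beta+1}v_{ij}v_{ij}^T-\xi_{ij,\beta}\xi_{ij,\beta}^T\},$$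 $$I_F(\alpha)=\frac1{IJ}\sum_{i=1}^I\begin{pmatrix}\frac1{\alpha_0^2}&\frac{w_i}{\alpha_0}\\ \frac{w_i}{\alpha_0}&w_i^2\end{pmatrix}\sum_{j=1}^Jt_j^2\frac{f_{ij}(\alpha)^2}{F_{ij}(\alpha)(1-F_{ij}(\alpha))}.$$ Then the following hold. 1. For all data and all $\alpha\in\Theta$, the limit $d_0(\hat p,p(\alpha))$ exists and equals the Kullback-Leibler divergence $\sum_m\hat p_m\log(\hat p_m/p_m(\alpha))$, and $H_\beta(\alpha)+\frac1\beta\to-\frac1{IJK}\log\mathcal L(\alpha)$ as $\beta\to0^+$. For all data, a point is an MDPDE with $\beta=0$ if and only if it is a maximum likelihood estimate, that is, a maximizer of $\mathcal L$ over $\Theta$. 2. For all $K\ge 1$ and $\alpha\in\Theta$, $I_F(\alpha)$ is the Fisher information matrix of the model, $I_F(\alpha)=\frac1{IJK}E_\alpha\bigl[-\partial^2\log\mathcal L(\alpha)/\partial\alpha\,\partial\alpha^T\bigr]$; and if the temperatures are not all equal, it is positive definite. 3. Suppose that the temperatures are not all equal, let $\alpha^*\in\Theta$ be the true parameter, and let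 $(y_{ijk})_{i\le I,\,j\le J,\,k\ge1}$ be independent with $y_{ijk}\sim\mathrm{Ber}(F_{ij}(\alpha^*))$. Then the probability that the data $(y_{ijk})_{k\le K}$ admit an MDPDE with $\beta=0$ tends to $1$ as $K\to\infty$. If $\hat\alpha_K$ are random vectors such that, for every $K\ge 1$, $\hat\alpha_K$ is almost surely such an estimate whenever one exists, then $$\sqrt K(\hat\alpha_K-\alpha^*)\xrightarrow[K\to\infty]{\mathcal L}\mathcal N\Bigl(0,\tfrac1{IJ}I_F^{-1}(\alpha^*)\Bigr).$$ 4. For all $\alpha\in\Theta$, $J_{\beta=0}(\alpha)=K_{\beta=0}(\alpha)=I_F(\alpha)$. -/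

import Mathlib

open MeasureTheory ProbabilityTheory Filter
open scoped Topology

namespace OneShot

noncomputable section

/-- The parameter vector `(α₀, α₁)`; its coordinates are `a 0` and `a 1`. -/
abbrev Param : Type := EuclideanSpace ℝ (Fin 2)

/-- The parameter space `Θ = (0, ∞) × ℝ`. -/
def paramSpace : Set Param := {a | 0 < a 0}

/-- The failure rate `λ_w(α) = α₀ exp(α₁ w)` at temperature `w`. -/
def failRate (a : Param) (w : ℝ) : ℝ := a 0 * Real.exp (a 1 * w)

/-- The exponential distribution function `F(t | λ_w(α))`. -/
def lifeCdf (a : Param) (w t : ℝ) : ℝ := 1 - Real.exp (-(failRate a w * t))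

/-- The exponential density `f(t | λ_w(α))`. -/
def lifeDensity (a : Param) (w t : ℝ) : ℝ := failRate a w * Real.exp (-(failRate a w * t))

/-- The observations `y_{ijk}` of an experiment with `K` devices at each of the `I * J` test
conditions; `true` (that is, `1`) records a failure. -/
abbrev Data (I J K : ℕ) : Type := Fin I → Fin J → Fin K → Bool

section Model

variable {I J K : ℕ}

/-- The number of failures `n_{ij} = ∑ₖ y_{ijk}`. -/
def failures (y : Data I J K) (i : Fin I) (j : Fin J) : ℕ := ∑ k, (y i j k).toNat

/-- The theoretical probability vector `p(α)`, of dimension `2IJ`. -/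
def modelProb (w : Fin I → ℝ) (t : Fin J → ℝ) (a : Param) : Fin I × Fin J × Bool → ℝ
  | (i, j, true) => lifeCdf a (w i) (t j) / ((I : ℝ) * J)
  | (i, j, false) => (1 - lifeCdf a (w i) (t j)) / ((I : ℝ) * J)

/-- The observed probability vector, of dimension `2IJ`. -/
def obsProb (y : Data I J K) : Fin I × Fin J × Bool → ℝ
  | (i, j, true) => (failures y i j : ℝ) / ((I : ℝ) * J * K)
  | (i, j, false) => ((K : ℝ) - failures y i j) / ((I : ℝ) * J * K)

/-- The likelihood function. -/
def likelihood (w : Fin I → ℝ) (t : Fin J → ℝ) (y : Data I J K) (a : Param) : ℝ :=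
  ∏ i, ∏ j, lifeCdf a (w i) (t j) ^ failures y i j *
    (1 - lifeCdf a (w i) (t j)) ^ (K - failures y i j)

/-- `a` is a maximum likelihood estimate for the data `y`. -/
def IsMLE (w : Fin I → ℝ) (t : Fin J → ℝ) (y : Data I J K) (a : Param) : Prop :=
  a ∈ paramSpace ∧ ∀ b ∈ paramSpace, likelihood w t y b ≤ likelihood w t y a

/-- The Kullback-Leibler divergence between two probability vectors (with `0 log 0 = 0`). -/
def klVec {ι : Type*} [Fintype ι] (p q : ι → ℝ) : ℝ := ∑ m, p m * Real.log (p m / q m)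

/-- The density power divergence with tuning parameter `β > 0`. -/
def dpdPos {ι : Type*} [Fintype ι] (β : ℝ) (p q : ι → ℝ) : ℝ :=
  ∑ m, (q m ^ (β + 1) - (1 + 1 / β) * q m ^ β * p m + 1 / β * p m ^ (1 + β))

/-- The density power divergence with tuning parameter `β ≥ 0`; for `β = 0` it is the limit as
`β → 0⁺`. -/
def dpd {ι : Type*} [Fintype ι] (β : ℝ) (p q : ι → ℝ) : ℝ :=
  if β = 0 then limUnder (𝓝[>] (0 : ℝ)) (fun b => dpdPos b p q) else dpdPos β p q

/-- The loss `V(y, β)` of one Bernoulli observation with success probability `π`, for `β > 0`. -/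
def lossV (π β : ℝ) (y : Bool) : ℝ :=
  π ^ (β + 1) + (1 - π) ^ (β + 1)
    - (1 + β) / β * (π ^ y.toNat * (1 - π) ^ (1 - y.toNat)) ^ β

/-- The average loss that defines the estimator for `β > 0`. -/
def meanLoss (w : Fin I → ℝ) (t : Fin J → ℝ) (β : ℝ) (y : Data I J K) (a : Param) : ℝ :=
  1 / ((I : ℝ) * J * K) * ∑ i, ∑ j, ∑ k, lossV (lifeCdf a (w i) (t j)) β (y i j k)

/-- The objective minimized by the minimum density power divergence estimator: the average loss for
`β > 0`, and for `β = 0`, where the loss is not defined, the limiting density power divergence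
between the observed and the theoretical probability vectors. -/
def mdpdeObjective (w : Fin I → ℝ) (t : Fin J → ℝ) (β : ℝ) (y : Data I J K) (a : Param) : ℝ :=
  if β = 0 then dpd 0 (obsProb y) (modelProb w t a) else meanLoss w t β y a

/-- `a` is a minimum density power divergence estimate, with tuning parameter `β`, for the
data `y`. -/
def IsMDPDE (w : Fin I → ℝ) (t : Fin J → ℝ) (β : ℝ) (y : Data I J K) (a : Param) : Prop :=
  a ∈ paramSpace ∧ ∀ b ∈ paramSpace, mdpdeObjective w t β y a ≤ mdpdeObjective w t β y b

/-- The law of a single observation: `Ber(F(t | λ_w(α)))`. The projection to `[0, 1]` changes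
nothing for `α ∈ Θ` and `t ≥ 0`. -/
def obsLaw (a : Param) (w t : ℝ) : Measure Bool :=
  bernoulliMeasure true false (Set.projIcc (0 : ℝ) 1 zero_le_one (lifeCdf a w t))

/-- The joint law of the `IJK` independent observations under the parameter `a`. -/
def dataLaw (w : Fin I → ℝ) (t : Fin J → ℝ) (K : ℕ) (a : Param) : Measure (Data I J K) :=
  Measure.pi fun i => Measure.pi fun j => Measure.pi fun _ => obsLaw a (w i) (t j)

/-- The partial derivative of `g` with respect to the coordinate `r` of the parameter. -/
def partialD (r : Fin 2) (g : Param → ℝ) (a : Param) : ℝ :=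
  lineDeriv ℝ g a (EuclideanSpace.single r 1)

/-- The Fisher information matrix of the model, per observation: the expectation of minus the
Hessian of the log-likelihood of the `IJK` observations, divided by `IJK`. -/
def fisherInfo (w : Fin I → ℝ) (t : Fin J → ℝ) (K : ℕ) (a : Param) : Matrix (Fin 2) (Fin 2) ℝ :=
  Matrix.of fun r s => 1 / ((I : ℝ) * J * K) *
    ∫ y : Data I J K,
      -partialD s (partialD r (fun b => Real.log (likelihood w t y b))) a ∂(dataLaw w t K a)

/-- The explicit matrix `I_F(α)`. -/
def fisherMatrix (w : Fin I → ℝ) (t : Fin J → ℝ) (a : Param) : Matrix (Fin 2) (Fin 2) ℝ :=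
  (1 / ((I : ℝ) * J)) • ∑ i,
    (∑ j, t j ^ 2 * (lifeDensity a (w i) (t j) ^ 2 /
      (lifeCdf a (w i) (t j) * (1 - lifeCdf a (w i) (t j))))) •
      !![1 / a 0 ^ 2, w i / a 0; w i / a 0, w i ^ 2]

/-- `u(α)`, the gradient of `log F(t | λ_w(α))`. -/
def scoreU (a : Param) (w t : ℝ) : Fin 2 → ℝ := fun r =>
  partialD r (fun b => Real.log (lifeCdf b w t)) a

/-- `v(α)`, the gradient of `log (1 - F(t | λ_w(α)))`. -/
def scoreV (a : Param) (w t : ℝ) : Fin 2 → ℝ := fun r =>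
  partialD r (fun b => Real.log (1 - lifeCdf b w t)) a

/-- The matrix `J_β(α) = (IJ)⁻¹ ∑ᵢⱼ J_{ij,β}(α)`. -/
def matJ (w : Fin I → ℝ) (t : Fin J → ℝ) (β : ℝ) (a : Param) : Matrix (Fin 2) (Fin 2) ℝ :=
  (1 / ((I : ℝ) * J)) • ∑ i, ∑ j,
    (lifeCdf a (w i) (t j) ^ (β + 1) •
        Matrix.vecMulVec (scoreU a (w i) (t j)) (scoreU a (w i) (t j))
      + (1 - lifeCdf a (w i) (t j)) ^ (β + 1) •
        Matrix.vecMulVec (scoreV a (w i) (t j)) (scoreV a (w i) (t j)))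

/-- The vector `ξ_β(α)` of one test condition. -/
def vecXi (a : Param) (w t β : ℝ) : Fin 2 → ℝ :=
  lifeCdf a w t ^ (β + 1) • scoreU a w t + (1 - lifeCdf a w t) ^ (β + 1) • scoreV a w t

/-- The matrix `K_β(α) = (IJ)⁻¹ ∑ᵢⱼ (S_{ij,β}(α) - ξ_{ij,β}(α) ξ_{ij,β}(α)ᵀ)`. -/
def matK (w : Fin I → ℝ) (t : Fin J → ℝ) (β : ℝ) (a : Param) : Matrix (Fin 2) (Fin 2) ℝ :=
  (1 / ((I : ℝ) * J)) • ∑ i, ∑ j,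
    (lifeCdf a (w i) (t j) ^ (2 * β + 1) •
        Matrix.vecMulVec (scoreU a (w i) (t j)) (scoreU a (w i) (t j))
      + (1 - lifeCdf a (w i) (t j)) ^ (2 * β + 1) •
        Matrix.vecMulVec (scoreV a (w i) (t j)) (scoreV a (w i) (t j))
      - Matrix.vecMulVec (vecXi a (w i) (t j) β) (vecXi a (w i) (t j) β))

end Model

end

end OneShot

/-! Write `x = λ_w(α) t` for the cumulative hazard of a test condition and `F = 1 - exp (-x)`. Since
`log x = log α₀ + α₁ w + log t` is affine in `(log α₀, α₁)`, every gradient is a multiple of the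
single vector `covariate`, and the matrix identities reduce to scalar ones per condition. The limits
`β → 0⁺` are computed term by term; the Kullback-Leibler divergence is a constant minus a positive
multiple of `log 𝓛`, so the two optimization problems agree.

The asymptotics need no consistency argument. In `s = log x` the Bernoulli log-likelihood `p log (1
- exp (-exp s)) - (1 - p) exp s` is strictly concave when `p < 1`. If two temperatures differ, any
zero of the score is therefore the unique global maximizer of the likelihood
(`meanLogLik_lt_of_score_eq_zero`). The score depends on the data only through the failure
frequencies. At the true probabilities it vanishes at `α*`, and its derivative in the parameter is
`-IJ · I_F`, which is invertible. The implicit function theorem then yields a function `φ`,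
differentiable at the true probabilities, such that the estimate exists, is unique and equals `φ` of
the frequencies whenever these lie in a fixed neighbourhood (`exists_estimate_function`).

Chebyshev's inequality puts the frequencies in that neighbourhood with probability tending to `1`,
and the delta method replaces `φ` by its derivative. What remains is a central limit theorem for
`IJ` independent cells, each moving along its own vector (`tendstoInDistribution_sum_smul`). Its
covariance collapses to `(IJ · I_F)⁻¹` by `sum_variance_mul_inner_influence_sq`. -/

namespace OneShot

/-! ### Gradients of one test condition and the matrices at `β = 0` -/

/-- The cumulative hazard `λ_w(α) t`. -/
noncomputable def cumHazard (a : Param) (w t : ℝ) : ℝ := failRate a w * t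

/-- The gradient `(1 / α₀, w)` of `log λ_w(α)`. -/
noncomputable def covariate (a : Param) (w : ℝ) : Param := !₂[1 / a 0, w]

@[simp]
lemma covariate_zero (a : Param) (w : ℝ) : covariate a w 0 = 1 / a 0 := rfl

@[simp]
lemma covariate_one (a : Param) (w : ℝ) : covariate a w 1 = w := rfl

lemma inner_covariate (a v : Param) (w : ℝ) :
    inner ℝ (covariate a w) v = v 0 / a 0 + w * v 1 := by
  simp [PiLp.inner_apply, Fin.sum_univ_two]
  ring

lemma inner_covariate_single (a : Param) (w : ℝ) (r : Fin 2) :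
    inner ℝ (covariate a w) (EuclideanSpace.single r (1 : ℝ)) = covariate a w r := by
  simp [EuclideanSpace.inner_single_right]

lemma lifeCdf_eq (a : Param) (w t : ℝ) : lifeCdf a w t = 1 - Real.exp (-cumHazard a w t) := rfl

lemma one_sub_lifeCdf (a : Param) (w t : ℝ) :
    1 - lifeCdf a w t = Real.exp (-cumHazard a w t) := by
  rw [lifeCdf_eq]; ring

lemma isOpen_paramSpace : IsOpen paramSpace :=
  isOpen_lt continuous_const (by fun_prop)

section Basic

variable {a : Param} {w t : ℝ}

lemma cumHazard_pos (ha : a ∈ paramSpace) (ht : 0 < t) : 0 < cumHazard a w t :=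
  mul_pos (mul_pos ha (Real.exp_pos _)) ht

lemma lifeCdf_pos (ha : a ∈ paramSpace) (ht : 0 < t) : 0 < lifeCdf a w t := by
  rw [lifeCdf_eq, sub_pos, Real.exp_lt_one_iff]
  exact neg_lt_zero.2 (cumHazard_pos ha ht)

lemma one_sub_lifeCdf_pos : 0 < 1 - lifeCdf a w t := by
  rw [one_sub_lifeCdf]; positivity

lemma lifeCdf_lt_one : lifeCdf a w t < 1 := sub_pos.1 one_sub_lifeCdf_pos

lemma hasStrictFDerivAt_coord (a : Param) (r : Fin 2) :
    HasStrictFDerivAt (fun b : Param => b r) (EuclideanSpace.proj r : Param →L[ℝ] ℝ) a :=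
  (EuclideanSpace.proj r : Param →L[ℝ] ℝ).hasStrictFDerivAt

/-- The logarithm of the hazard has gradient `covariate`. Strict differentiability is what the
implicit function theorem requires later. -/
lemma hasStrictFDerivAt_cumHazard (ha : a ∈ paramSpace) :
    HasStrictFDerivAt (fun b => cumHazard b w t)
      (cumHazard a w t • innerSL ℝ (covariate a w)) a := by
  have ha' : a 0 ≠ 0 := ne_of_gt ha
  have h := ((hasStrictFDerivAt_coord a 0).mul
    ((hasStrictFDerivAt_coord a 1).mul_const w).exp).mul_const t
  refine h.congr_fderiv ?_
  ext v
  simp [inner_covariate, cumHazard, failRate]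
  field_simp
  ring

lemma hasStrictFDerivAt_lifeCdf (ha : a ∈ paramSpace) :
    HasStrictFDerivAt (fun b => lifeCdf b w t)
      ((cumHazard a w t * (1 - lifeCdf a w t)) • innerSL ℝ (covariate a w)) a := by
  have h := ((hasStrictFDerivAt_cumHazard (w := w) (t := t) ha).neg.exp).const_sub 1
  refine h.congr_fderiv ?_
  ext v
  simp [one_sub_lifeCdf]
  ring

lemma hasFDerivAt_log_lifeCdf (ha : a ∈ paramSpace) (ht : 0 < t) :
    HasFDerivAt (fun b => Real.log (lifeCdf b w t))
      ((cumHazard a w t * (1 - lifeCdf a w t) / lifeCdf a w t) • innerSL ℝ (covariate a w)) a := by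
  refine ((hasStrictFDerivAt_lifeCdf ha).hasFDerivAt.log (lifeCdf_pos ha ht).ne').congr_fderiv ?_
  ext v
  simp
  ring

lemma hasFDerivAt_log_one_sub_lifeCdf (ha : a ∈ paramSpace) :
    HasFDerivAt (fun b => Real.log (1 - lifeCdf b w t))
      ((-cumHazard a w t) • innerSL ℝ (covariate a w)) a := by
  simp_rw [one_sub_lifeCdf, Real.log_exp]
  refine ((hasStrictFDerivAt_cumHazard ha).hasFDerivAt.neg).congr_fderiv ?_
  ext v
  simp

end Basic

lemma _root_.HasFDerivAt.partialD_eq {g : Param → ℝ} {g' : Param →L[ℝ] ℝ} {a : Param}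
    (h : HasFDerivAt g g' a) (r : Fin 2) : partialD r g a = g' (EuclideanSpace.single r 1) :=
  (h.hasLineDerivAt _).lineDeriv

lemma partialD_congr {g h : Param → ℝ} {a : Param} (hgh : g =ᶠ[𝓝 a] h) (r : Fin 2) :
    partialD r g a = partialD r h a :=
  hgh.lineDeriv_eq

section Scores

variable {a : Param} {w t : ℝ}

lemma scoreU_eq (ha : a ∈ paramSpace) (ht : 0 < t) :
    scoreU a w t =
      (cumHazard a w t * (1 - lifeCdf a w t) / lifeCdf a w t) • (covariate a w).ofLp := by
  ext r
  rw [scoreU, (hasFDerivAt_log_lifeCdf ha ht).partialD_eq]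
  simp [inner_covariate_single]

lemma scoreV_eq (ha : a ∈ paramSpace) :
    scoreV a w t = (-cumHazard a w t) • (covariate a w).ofLp := by
  ext r
  rw [scoreV, (hasFDerivAt_log_one_sub_lifeCdf ha).partialD_eq]
  simp [inner_covariate_single]

/-- At `β = 0` the vector is `∇F + ∇(1 - F)`, the gradient of a constant. -/
lemma vecXi_zero (ha : a ∈ paramSpace) (ht : 0 < t) : vecXi a w t 0 = 0 := by
  have h := (lifeCdf_pos (w := w) ha ht).ne'
  rw [vecXi, scoreU_eq ha ht, scoreV_eq ha]
  ext r
  simp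
  field_simp
  ring

end Scores

section Matrices

variable {I J : ℕ} {w : Fin I → ℝ} {t : Fin J → ℝ} {a : Param}

/-- The Fisher information, about the log failure rate, of one observation. -/
noncomputable def infoWeight (a : Param) (w t : ℝ) : ℝ :=
  cumHazard a w t ^ 2 * (1 - lifeCdf a w t) / lifeCdf a w t

lemma infoWeight_pos {w t : ℝ} (ha : a ∈ paramSpace) (ht : 0 < t) : 0 < infoWeight a w t :=
  div_pos (mul_pos (pow_pos (cumHazard_pos ha ht) 2) one_sub_lifeCdf_pos) (lifeCdf_pos ha ht)

lemma fisherMatrix_apply (ht : ∀ j, 0 < t j) (ha : a ∈ paramSpace) (r s : Fin 2) :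
    fisherMatrix w t a r s = 1 / ((I : ℝ) * J) *
      ∑ i, ∑ j, infoWeight a (w i) (t j) * (covariate a (w i) r * covariate a (w i) s) := by
  have ha' : a 0 ≠ 0 := ne_of_gt ha
  simp only [fisherMatrix, Matrix.smul_apply, Matrix.sum_apply, smul_eq_mul, Finset.sum_mul]
  congr 1
  refine Finset.sum_congr rfl fun i _ => Finset.sum_congr rfl fun j _ => ?_
  have h1 := (lifeCdf_pos (w := w i) ha (ht j)).ne'
  have h2 : lifeDensity a (w i) (t j) = failRate a (w i) * (1 - lifeCdf a (w i) (t j)) := by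
    rw [one_sub_lifeCdf]; rfl
  have h3 := (one_sub_lifeCdf_pos (a := a) (w := w i) (t := t j)).ne'
  rw [infoWeight, cumHazard, h2]
  fin_cases r <;> fin_cases s <;> simp <;> field_simp

/-- Per condition, `F (x (1 - F) / F)² + (1 - F) x² = x² (1 - F) / F`. -/
lemma matJ_zero (ht : ∀ j, 0 < t j) (ha : a ∈ paramSpace) :
    matJ w t 0 a = fisherMatrix w t a := by
  ext r s
  rw [fisherMatrix_apply ht ha]
  simp only [matJ, Matrix.smul_apply, Matrix.sum_apply, smul_eq_mul]
  congr 1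
  refine Finset.sum_congr rfl fun i _ => Finset.sum_congr rfl fun j _ => ?_
  have h1 := (lifeCdf_pos (w := w i) ha (ht j)).ne'
  rw [scoreU_eq ha (ht j), scoreV_eq ha, infoWeight]
  simp [Matrix.vecMulVec_apply]
  field_simp
  ring

lemma matK_zero (ht : ∀ j, 0 < t j) (ha : a ∈ paramSpace) : matK w t 0 a = matJ w t 0 a := by
  simp only [matK, matJ, mul_zero, vecXi_zero ha (ht _)]
  simp

end Matrices

end OneShot

namespace OneShot

/-! ### Limits as `β → 0⁺` -/

section DensityPowerDivergence

lemma tendsto_rpow_zero_nhdsGT {c : ℝ} (hc : 0 < c) :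
    Tendsto (fun β : ℝ => c ^ β) (𝓝[>] 0) (𝓝 1) := by
  have h : ContinuousAt (fun β : ℝ => c ^ β) 0 := Real.continuousAt_const_rpow hc.ne'
  simpa using h.tendsto.mono_left nhdsWithin_le_nhds

lemma tendsto_rpow_add_one_nhdsGT {c : ℝ} (hc : 0 < c) :
    Tendsto (fun β : ℝ => c ^ (β + 1)) (𝓝[>] 0) (𝓝 c) := by
  simp_rw [Real.rpow_add_one hc.ne']
  simpa using (tendsto_rpow_zero_nhdsGT hc).mul_const c

lemma tendsto_rpow_sub_one_div_nhdsGT {c : ℝ} (hc : 0 < c) :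
    Tendsto (fun β : ℝ => (c ^ β - 1) / β) (𝓝[>] 0) (𝓝 (Real.log c)) := by
  have h : HasDerivAt (fun β : ℝ => c ^ β) (Real.log c) 0 := by
    simpa using (hasDerivAt_id (0 : ℝ)).const_rpow hc
  refine h.tendsto_slope_zero_right.congr fun β => ?_
  simp
  ring

/-- The poles combine into `p ((p ^ β - 1) / β - (q ^ β - 1) / β)`, which tends to `p log (p / q)`.
The leftover `q - p` disappears only after summation, when both vectors have the same mass. -/
lemma tendsto_dpdPos_summand {p q : ℝ} (hp : 0 ≤ p) (hq : 0 < q) :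
    Tendsto (fun β : ℝ => q ^ (β + 1) - (1 + 1 / β) * q ^ β * p + 1 / β * p ^ (1 + β)) (𝓝[>] 0)
      (𝓝 (q - p + p * Real.log (p / q))) := by
  obtain rfl | hp := hp.eq_or_lt
  · have h := tendsto_rpow_add_one_nhdsGT hq
    simp only [mul_zero, sub_zero, zero_mul, add_zero]
    refine h.congr' ?_
    filter_upwards [self_mem_nhdsWithin] with β hβ
    have : 1 + β ≠ 0 := by linarith [Set.mem_Ioi.1 hβ]
    simp [Real.zero_rpow this]
  · have h := ((tendsto_rpow_add_one_nhdsGT hq).sub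
      ((tendsto_rpow_zero_nhdsGT hq).mul_const p)).add
        (((tendsto_rpow_sub_one_div_nhdsGT hp).sub
          (tendsto_rpow_sub_one_div_nhdsGT hq)).const_mul p)
    rw [Real.log_div hp.ne' hq.ne']
    rw [one_mul] at h
    refine h.congr' ?_
    filter_upwards [self_mem_nhdsWithin] with β hβ
    have : β ≠ 0 := (Set.mem_Ioi.1 hβ).ne'
    rw [Real.rpow_add hp, Real.rpow_one]
    field_simp
    ring

lemma tendsto_dpdPos {ι : Type*} [Fintype ι] {p q : ι → ℝ} (hp : ∀ m, 0 ≤ p m)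
    (hq : ∀ m, 0 < q m) (hpq : ∑ m, p m = ∑ m, q m) :
    Tendsto (fun β => dpdPos β p q) (𝓝[>] 0) (𝓝 (klVec p q)) := by
  have h := tendsto_finsetSum Finset.univ fun m _ => tendsto_dpdPos_summand (hp m) (hq m)
  have e : klVec p q = ∑ m, (q m - p m + p m * Real.log (p m / q m)) := by
    rw [Finset.sum_add_distrib, Finset.sum_sub_distrib, hpq, sub_self, zero_add, klVec]
  rw [e]
  exact h

lemma dpd_zero_eq_klVec {ι : Type*} [Fintype ι] {p q : ι → ℝ} (hp : ∀ m, 0 ≤ p m)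
    (hq : ∀ m, 0 < q m) (hpq : ∑ m, p m = ∑ m, q m) : dpd 0 p q = klVec p q := by
  rw [dpd, if_pos rfl]
  exact (tendsto_dpdPos hp hq hpq).limUnder_eq

lemma tendsto_dpd {ι : Type*} [Fintype ι] {p q : ι → ℝ} (hp : ∀ m, 0 ≤ p m)
    (hq : ∀ m, 0 < q m) (hpq : ∑ m, p m = ∑ m, q m) :
    Tendsto (fun β => dpd β p q) (𝓝[>] 0) (𝓝 (dpd 0 p q)) := by
  rw [dpd_zero_eq_klVec hp hq hpq]
  refine (tendsto_dpdPos hp hq hpq).congr' ?_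
  filter_upwards [self_mem_nhdsWithin] with β hβ
  rw [dpd, if_neg (Set.mem_Ioi.1 hβ).ne']

/-- For the Bernoulli weight `g`, `(1 + β) / β * g ^ β = g ^ β + (g ^ β - 1) / β + 1 / β`; the shift
removes the pole, and the bounded terms cancel in the limit because `π + (1 - π) = 1`. -/
lemma tendsto_lossV {π : ℝ} (h0 : 0 < π) (h1 : 0 < 1 - π) (y : Bool) :
    Tendsto (fun β => lossV π β y + 1 / β) (𝓝[>] 0)
      (𝓝 (-Real.log (π ^ y.toNat * (1 - π) ^ (1 - y.toNat)))) := by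
  have hg : 0 < π ^ y.toNat * (1 - π) ^ (1 - y.toNat) := by positivity
  have h := (((tendsto_rpow_add_one_nhdsGT h0).add (tendsto_rpow_add_one_nhdsGT h1)).sub
    (tendsto_rpow_zero_nhdsGT hg)).sub (tendsto_rpow_sub_one_div_nhdsGT hg)
  have e : π + (1 - π) - 1 - Real.log (π ^ y.toNat * (1 - π) ^ (1 - y.toNat)) =
      -Real.log (π ^ y.toNat * (1 - π) ^ (1 - y.toNat)) := by ring
  rw [e] at h
  refine h.congr' ?_
  filter_upwards [self_mem_nhdsWithin] with β hβ
  have : β ≠ 0 := (Set.mem_Ioi.1 hβ).ne'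
  rw [lossV]
  field_simp
  ring

end DensityPowerDivergence

/-! ### Likelihood, Kullback-Leibler divergence and equality of the estimates -/

section Likelihood

variable {I J K : ℕ} {w : Fin I → ℝ} {t : Fin J → ℝ} {a : Param}

lemma failures_le (y : Data I J K) (i : Fin I) (j : Fin J) : failures y i j ≤ K := by
  calc failures y i j ≤ ∑ _k : Fin K, 1 := Finset.sum_le_sum fun k _ => Bool.toNat_le _
    _ = K := by simp

lemma obsProb_nonneg (y : Data I J K) (m : Fin I × Fin J × Bool) : 0 ≤ obsProb y m := by
  obtain ⟨i, j, b⟩ := m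
  have h : (failures y i j : ℝ) ≤ K := by exact_mod_cast failures_le y i j
  cases b
  · exact div_nonneg (sub_nonneg.2 h) (by positivity)
  · exact div_nonneg (by positivity) (by positivity)

lemma sum_obsProb (hI : 0 < I) (hJ : 0 < J) (hK : 0 < K) (y : Data I J K) :
    ∑ m, obsProb y m = 1 := by
  simp only [Fintype.sum_prod_type, Fintype.sum_bool, obsProb, ← add_div, add_sub_cancel,
    Finset.sum_const, Finset.card_univ, Fintype.card_fin, nsmul_eq_mul]
  field_simp

lemma modelProb_pos (hI : 0 < I) (hJ : 0 < J) (ht : ∀ j, 0 < t j) (ha : a ∈ paramSpace)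
    (m : Fin I × Fin J × Bool) : 0 < modelProb w t a m := by
  obtain ⟨i, j, b⟩ := m
  have hIJ : 0 < (I : ℝ) * J := by positivity
  cases b
  · exact div_pos one_sub_lifeCdf_pos hIJ
  · exact div_pos (lifeCdf_pos ha (ht j)) hIJ

lemma sum_modelProb (hI : 0 < I) (hJ : 0 < J) (w : Fin I → ℝ) (t : Fin J → ℝ) (a : Param) :
    ∑ m, modelProb w t a m = 1 := by
  simp only [Fintype.sum_prod_type, Fintype.sum_bool, modelProb, ← add_div, add_sub_cancel,
    Finset.sum_const, Finset.card_univ, Fintype.card_fin, nsmul_eq_mul]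
  field_simp

lemma likelihood_pos (ht : ∀ j, 0 < t j) (ha : a ∈ paramSpace) (y : Data I J K) :
    0 < likelihood w t y a :=
  Finset.prod_pos fun _ _ => Finset.prod_pos fun j _ =>
    mul_pos (pow_pos (lifeCdf_pos ha (ht j)) _) (pow_pos one_sub_lifeCdf_pos _)

lemma log_likelihood (ht : ∀ j, 0 < t j) (ha : a ∈ paramSpace) (y : Data I J K) :
    Real.log (likelihood w t y a) = ∑ i, ∑ j,
      ((failures y i j : ℝ) * Real.log (lifeCdf a (w i) (t j)) +
        ((K : ℝ) - failures y i j) * Real.log (1 - lifeCdf a (w i) (t j))) := by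
  have h1 (i j) := (pow_pos (lifeCdf_pos (w := w i) ha (ht j)) (failures y i j)).ne'
  have h2 (i j) :=
    (pow_pos (one_sub_lifeCdf_pos (a := a) (w := w i) (t := t j)) (K - failures y i j)).ne'
  rw [likelihood, Real.log_prod fun i _ => Finset.prod_ne_zero_iff.2 fun j _ =>
    mul_ne_zero (h1 i j) (h2 i j)]
  refine Finset.sum_congr rfl fun i _ => ?_
  rw [Real.log_prod fun j _ => mul_ne_zero (h1 i j) (h2 i j)]
  refine Finset.sum_congr rfl fun j _ => ?_
  rw [Real.log_mul (h1 i j) (h2 i j), Real.log_pow, Real.log_pow,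
    Nat.cast_sub (failures_le y i j)]

lemma sum_log_bernoulli {n : ℕ} (π : ℝ) (y : Fin n → Bool) :
    ∑ k, Real.log (π ^ (y k).toNat * (1 - π) ^ (1 - (y k).toNat)) =
      ((∑ k, (y k).toNat : ℕ) : ℝ) * Real.log π +
        ((n : ℝ) - (∑ k, (y k).toNat : ℕ)) * Real.log (1 - π) := by
  have h (k : Fin n) : Real.log (π ^ (y k).toNat * (1 - π) ^ (1 - (y k).toNat)) =
      (y k).toNat * Real.log π + (1 - (y k).toNat) * Real.log (1 - π) := by
    cases y k <;> simp
  simp only [h, Finset.sum_add_distrib, ← Finset.sum_mul, Finset.sum_sub_distrib, Nat.cast_sum]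
  simp

lemma tendsto_meanLoss (hI : 0 < I) (hJ : 0 < J) (hK : 0 < K) (ht : ∀ j, 0 < t j)
    (ha : a ∈ paramSpace) (y : Data I J K) :
    Tendsto (fun β => meanLoss w t β y a + 1 / β) (𝓝[>] 0)
      (𝓝 (-(1 / ((I : ℝ) * J * K) * Real.log (likelihood w t y a)))) := by
  have h := (tendsto_finsetSum Finset.univ fun i _ => tendsto_finsetSum Finset.univ fun j _ =>
    tendsto_finsetSum Finset.univ fun k _ => tendsto_lossV (lifeCdf_pos (w := w i) ha (ht j))
      one_sub_lifeCdf_pos (y i j k)).const_mul (1 / ((I : ℝ) * J * K))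
  have e : -(1 / ((I : ℝ) * J * K) * Real.log (likelihood w t y a)) =
      1 / ((I : ℝ) * J * K) * ∑ i, ∑ j, ∑ k, -Real.log (lifeCdf a (w i) (t j) ^ (y i j k).toNat *
        (1 - lifeCdf a (w i) (t j)) ^ (1 - (y i j k).toNat)) := by
    rw [log_likelihood ht ha, ← mul_neg]
    simp_rw [Finset.sum_neg_distrib,
      fun i j => sum_log_bernoulli (lifeCdf a (w i) (t j)) (y i j)]
    rfl
  rw [e]
  refine h.congr fun β => ?_
  simp only [meanLoss, Finset.sum_add_distrib, mul_add, Finset.sum_const, Finset.card_univ,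
    Fintype.card_fin, nsmul_eq_mul]
  field_simp

lemma klVec_eq_sub_log_likelihood (hI : 0 < I) (hJ : 0 < J) (w : Fin I → ℝ)
    (ht : ∀ j, 0 < t j) (y : Data I J K) :
    ∃ C : ℝ, ∀ a ∈ paramSpace, klVec (obsProb y) (modelProb w t a) =
      C - 1 / ((I : ℝ) * J * K) * Real.log (likelihood w t y a) := by
  -- The constant is the negative entropy of the observed vector; `log (IJ)` undoes the
  -- normalization in `modelProb`, leaving `log F` and `log (1 - F)`.
  refine ⟨∑ m, obsProb y m * (Real.log (obsProb y m) + Real.log ((I : ℝ) * J)), fun a ha => ?_⟩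
  have h (m) : obsProb y m * Real.log (obsProb y m / modelProb w t a m) =
      obsProb y m * (Real.log (obsProb y m) + Real.log ((I : ℝ) * J)) -
        obsProb y m * (Real.log (modelProb w t a m) + Real.log ((I : ℝ) * J)) := by
    obtain h0 | h0 := eq_or_ne (obsProb y m) 0
    · simp [h0]
    · rw [Real.log_div h0 (modelProb_pos hI hJ ht ha m).ne']
      ring
  have hIJ : (I : ℝ) * J ≠ 0 := by positivity
  rw [klVec, Finset.sum_congr rfl fun m _ => h m, Finset.sum_sub_distrib, log_likelihood ht ha,
    Finset.mul_sum]
  congr 1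
  simp only [Fintype.sum_prod_type, Fintype.sum_bool]
  refine Finset.sum_congr rfl fun i _ => ?_
  rw [Finset.mul_sum]
  refine Finset.sum_congr rfl fun j _ => ?_
  rw [modelProb, modelProb, Real.log_div (lifeCdf_pos ha (ht j)).ne' hIJ,
    Real.log_div one_sub_lifeCdf_pos.ne' hIJ, obsProb, obsProb]
  ring

lemma isMDPDE_zero_iff_isMLE (hI : 0 < I) (hJ : 0 < J) (hK : 0 < K) (ht : ∀ j, 0 < t j)
    (y : Data I J K) : IsMDPDE w t 0 y a ↔ IsMLE w t y a := by
  obtain ⟨C, hC⟩ := klVec_eq_sub_log_likelihood hI hJ w ht y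
  have h (b) (hb : b ∈ paramSpace) : mdpdeObjective w t 0 y b =
      C - 1 / ((I : ℝ) * J * K) * Real.log (likelihood w t y b) := by
    rw [mdpdeObjective, if_pos rfl, dpd_zero_eq_klVec (obsProb_nonneg y)
      (modelProb_pos hI hJ ht hb) (by rw [sum_obsProb hI hJ hK, sum_modelProb hI hJ]), hC b hb]
  refine and_congr_right fun ha => forall₂_congr fun b hb => ?_
  have hIJK : 0 < 1 / ((I : ℝ) * J * K) := by positivity
  rw [h a ha, h b hb, sub_le_sub_iff_left, mul_le_mul_iff_right₀ hIJK,
    Real.log_le_log_iff (likelihood_pos ht hb y) (likelihood_pos ht ha y)]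

end Likelihood

/-! ### The Fisher information as an expected Hessian -/

section FisherInformation

variable {I J K : ℕ} {w : Fin I → ℝ} {t : Fin J → ℝ} {a : Param}

instance isProbabilityMeasure_obsLaw (a : Param) (w t : ℝ) : IsProbabilityMeasure (obsLaw a w t) := by
  unfold obsLaw; infer_instance

instance isProbabilityMeasure_dataLaw (w : Fin I → ℝ) (t : Fin J → ℝ) (K : ℕ) (a : Param) :
    IsProbabilityMeasure (dataLaw w t K a) := by
  unfold dataLaw; infer_instance

lemma integral_obsLaw {w t : ℝ} (ha : a ∈ paramSpace) (ht : 0 < t) (f : Bool → ℝ) :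
    ∫ z, f z ∂obsLaw a w t = lifeCdf a w t * f true + (1 - lifeCdf a w t) * f false := by
  rw [obsLaw, integral_bernoulliMeasure,
    Set.projIcc_of_mem _ ⟨(lifeCdf_pos ha ht).le, lifeCdf_lt_one.le⟩]
  rfl

lemma measurePreserving_eval_dataLaw (w : Fin I → ℝ) (t : Fin J → ℝ) (a : Param)
    (i : Fin I) (j : Fin J) (k : Fin K) :
    MeasurePreserving (fun y : Data I J K => y i j k) (dataLaw w t K a)
      (obsLaw a (w i) (t j)) :=
  (measurePreserving_eval (fun _ : Fin K => obsLaw a (w i) (t j)) k).comp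
    ((measurePreserving_eval
      (fun j : Fin J => Measure.pi fun _ : Fin K => obsLaw a (w i) (t j)) j).comp
    (measurePreserving_eval (fun i : Fin I => Measure.pi fun j : Fin J =>
      Measure.pi fun _ : Fin K => obsLaw a (w i) (t j)) i))

lemma integral_failures (ht : ∀ j, 0 < t j) (ha : a ∈ paramSpace) (i : Fin I) (j : Fin J) :
    ∫ y : Data I J K, (failures y i j : ℝ) ∂dataLaw w t K a = K * lifeCdf a (w i) (t j) := by
  simp only [failures, Nat.cast_sum]
  rw [integral_finsetSum _ fun k _ => Integrable.of_finite]
  have h (k : Fin K) : ∫ y : Data I J K, ((y i j k).toNat : ℝ) ∂dataLaw w t K a =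
      lifeCdf a (w i) (t j) := by
    have h1 := (measurePreserving_eval_dataLaw w t a i j k).map_eq
    have h2 := integral_map (μ := dataLaw w t K a) (φ := fun y : Data I J K => y i j k)
      (f := fun b : Bool => (b.toNat : ℝ))
      (measurePreserving_eval_dataLaw w t a i j k).measurable.aemeasurable
      (by fun_prop)
    rw [← h2, h1, integral_obsLaw ha (ht j)]
    simp
  simp [h]

lemma differentiableAt_covariate (ha : a ∈ paramSpace) (w : ℝ) (r : Fin 2) :
    DifferentiableAt ℝ (fun b => covariate b w r) a := by
  have ha' : a 0 ≠ 0 := ne_of_gt ha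
  fin_cases r
  · have h : DifferentiableAt ℝ (fun b : Param => (b 0)⁻¹) a :=
      (hasStrictFDerivAt_coord a 0).hasFDerivAt.differentiableAt.fun_inv ha'
    simpa using h
  · exact differentiableAt_const w

/-- The two gradients combine through `n (1 - F) / F - (K - n) = n / F - K`, a factor with
expectation zero under the model. -/
lemma partialD_log_likelihood (ht : ∀ j, 0 < t j) (ha : a ∈ paramSpace) (y : Data I J K)
    (r : Fin 2) :
    partialD r (fun b => Real.log (likelihood w t y b)) a = ∑ i, ∑ j,
      cumHazard a (w i) (t j) * covariate a (w i) r *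
        (failures y i j * (lifeCdf a (w i) (t j))⁻¹ - K) := by
  have h : (fun b => Real.log (likelihood w t y b)) =ᶠ[𝓝 a] fun b => ∑ i, ∑ j,
      ((failures y i j : ℝ) * Real.log (lifeCdf b (w i) (t j)) +
        ((K : ℝ) - failures y i j) * Real.log (1 - lifeCdf b (w i) (t j))) := by
    filter_upwards [isOpen_paramSpace.mem_nhds ha] with b hb using log_likelihood ht hb y
  rw [partialD_congr h, HasFDerivAt.partialD_eq (HasFDerivAt.fun_sum fun i _ =>
    HasFDerivAt.fun_sum fun j _ => ((hasFDerivAt_log_lifeCdf ha (ht j)).const_mul _).fun_add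
      ((hasFDerivAt_log_one_sub_lifeCdf ha).const_mul _))]
  simp only [sum_apply]
  refine Finset.sum_congr rfl fun i _ => Finset.sum_congr rfl fun j _ => ?_
  have h1 := (lifeCdf_pos (w := w i) ha (ht j)).ne'
  simp [inner_covariate_single]
  field_simp
  ring

/-- `D` stays implicit: it multiplies the centred factor `n / F - K`, so it drops out of the
expectation and need not be computed. -/
lemma partialD_partialD_log_likelihood (ht : ∀ j, 0 < t j) (ha : a ∈ paramSpace) (r s : Fin 2) :
    ∃ D : Fin I → Fin J → ℝ, ∀ y : Data I J K,
      partialD s (partialD r (fun b => Real.log (likelihood w t y b))) a = ∑ i, ∑ j,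
        ((failures y i j * (lifeCdf a (w i) (t j))⁻¹ - K) * D i j -
          failures y i j * (lifeCdf a (w i) (t j))⁻¹ *
            (infoWeight a (w i) (t j) * (covariate a (w i) r * covariate a (w i) s))) := by
  have hd (i : Fin I) (j : Fin J) :
      HasFDerivAt (fun b => cumHazard b (w i) (t j) * covariate b (w i) r)
        (fderiv ℝ (fun b => cumHazard b (w i) (t j) * covariate b (w i) r) a) a :=
    ((hasStrictFDerivAt_cumHazard ha).hasFDerivAt.differentiableAt.mul
      (differentiableAt_covariate ha _ r)).hasFDerivAt
  refine ⟨fun i j => fderiv ℝ (fun b => cumHazard b (w i) (t j) * covariate b (w i) r) a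
    (EuclideanSpace.single s 1), fun y => ?_⟩
  have h : partialD r (fun b => Real.log (likelihood w t y b)) =ᶠ[𝓝 a] fun b => ∑ i, ∑ j,
      cumHazard b (w i) (t j) * covariate b (w i) r *
        (failures y i j * (lifeCdf b (w i) (t j))⁻¹ - K) := by
    filter_upwards [isOpen_paramSpace.mem_nhds ha] with b hb
    exact partialD_log_likelihood ht hb y r
  have hF (i : Fin I) (j : Fin J) : HasFDerivAt (fun b => (lifeCdf b (w i) (t j))⁻¹) _ a :=
    (hasDerivAt_inv (lifeCdf_pos ha (ht j)).ne').comp_hasFDerivAt a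
      (hasStrictFDerivAt_lifeCdf ha).hasFDerivAt
  rw [partialD_congr h, HasFDerivAt.partialD_eq (HasFDerivAt.fun_sum fun i _ =>
    HasFDerivAt.fun_sum fun j _ => (hd i j).fun_mul (((hF i j).const_mul _).sub_const _))]
  simp only [sum_apply]
  refine Finset.sum_congr rfl fun i _ => Finset.sum_congr rfl fun j _ => ?_
  have h1 := (lifeCdf_pos (w := w i) ha (ht j)).ne'
  simp [inner_covariate_single, infoWeight]
  field_simp
  ring

lemma fisherInfo_eq_fisherMatrix (hK : 0 < K) (ht : ∀ j, 0 < t j) (ha : a ∈ paramSpace) :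
    fisherInfo w t K a = fisherMatrix w t a := by
  ext r s
  obtain ⟨D, hD⟩ := partialD_partialD_log_likelihood (K := K) (w := w) ht ha r s
  rw [fisherMatrix_apply ht ha, fisherInfo, Matrix.of_apply]
  simp_rw [hD]
  rw [integral_neg, integral_finsetSum _ fun i _ => Integrable.of_finite]
  simp_rw [integral_finsetSum Finset.univ fun j _ => (Integrable.of_finite :
    Integrable _ (dataLaw w t K a)), integral_sub (Integrable.of_finite :
    Integrable _ (dataLaw w t K a)) (Integrable.of_finite : Integrable _ (dataLaw w t K a)),
    integral_mul_const, integral_sub (Integrable.of_finite :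
    Integrable _ (dataLaw w t K a)) (Integrable.of_finite : Integrable _ (dataLaw w t K a)),
    integral_mul_const, integral_failures ht ha]
  simp only [integral_const, probReal_univ, one_smul]
  rw [← Finset.sum_neg_distrib, Finset.mul_sum, Finset.mul_sum]
  refine Finset.sum_congr rfl fun i _ => ?_
  rw [← Finset.sum_neg_distrib, Finset.mul_sum, Finset.mul_sum]
  refine Finset.sum_congr rfl fun j _ => ?_
  have h1 := (lifeCdf_pos (w := w i) ha (ht j)).ne'
  field_simp
  ring

end FisherInformation

/-! ### Positive definiteness -/

section PositiveDefinite

variable {I J : ℕ} {w : Fin I → ℝ} {t : Fin J → ℝ} {a : Param}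

/-- All weights are positive, so a vanishing sum forces `v 0 / a 0 + w i * v 1 = 0` for every `i`;
two distinct temperatures then give `v = 0`. -/
lemma sum_infoWeight_sq_pos (hJ : 0 < J) (ht : ∀ j, 0 < t j) (hw : ∃ i i', w i ≠ w i')
    (ha : a ∈ paramSpace) {v : Param} (hv : v ≠ 0) :
    0 < ∑ i, ∑ j, infoWeight a (w i) (t j) * inner ℝ (covariate a (w i)) v ^ 2 := by
  have ha' : a 0 ≠ 0 := ne_of_gt ha
  have hnn (i j) : 0 ≤ infoWeight a (w i) (t j) * inner ℝ (covariate a (w i)) v ^ 2 :=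
    mul_nonneg (infoWeight_pos ha (ht j)).le (sq_nonneg _)
  refine (Finset.sum_nonneg fun i _ => Finset.sum_nonneg fun j _ => hnn i j).lt_of_ne' fun h0 => ?_
  have hz (i) : inner ℝ (covariate a (w i)) v = 0 := by
    have h1 := (Finset.sum_eq_zero_iff_of_nonneg
      (fun i _ => Finset.sum_nonneg fun j _ => hnn i j)).1 h0 i (Finset.mem_univ _)
    have h2 := (Finset.sum_eq_zero_iff_of_nonneg (fun j _ => hnn i j)).1 h1 ⟨0, hJ⟩
      (Finset.mem_univ _)
    simpa [(infoWeight_pos ha (ht _)).ne'] using h2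
  obtain ⟨i, i', hii⟩ := hw
  have h1 := hz i
  have h2 := hz i'
  rw [inner_covariate] at h1 h2
  have hv1 : v 1 = 0 := by
    have : (w i - w i') * v 1 = 0 := by linear_combination h1 - h2
    exact (mul_eq_zero.1 this).resolve_left (sub_ne_zero.2 hii)
  have hv0 : v 0 = 0 := by
    have : v 0 / a 0 = 0 := by simpa [hv1] using h1
    exact (div_eq_zero_iff.1 this).resolve_right ha'
  exact hv (by ext r; fin_cases r <;> simp [hv0, hv1])

/-- `I * J` times the Fisher information, as an operator. -/
noncomputable def infoOperator (w : Fin I → ℝ) (t : Fin J → ℝ) (a : Param) : Param →L[ℝ] Param :=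
  ∑ i, ∑ j, infoWeight a (w i) (t j) •
    (innerSL ℝ (covariate a (w i))).smulRight (covariate a (w i))

lemma infoOperator_apply (v : Param) : infoOperator w t a v = ∑ i, ∑ j,
    infoWeight a (w i) (t j) • inner ℝ (covariate a (w i)) v • covariate a (w i) := by
  simp [infoOperator]

lemma inner_infoOperator (u v : Param) : inner ℝ u (infoOperator w t a v) = ∑ i, ∑ j,
    infoWeight a (w i) (t j) *
      (inner ℝ (covariate a (w i)) u * inner ℝ (covariate a (w i)) v) := by
  simp only [infoOperator_apply, inner_sum, inner_smul_right]
  refine Finset.sum_congr rfl fun i _ => Finset.sum_congr rfl fun j _ => ?_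
  rw [real_inner_comm (covariate a (w i)) u]
  ring

lemma infoOperator_eq_mulVec (hI : 0 < I) (hJ : 0 < J) (ht : ∀ j, 0 < t j) (ha : a ∈ paramSpace)
    (v : Param) : (infoOperator w t a v).ofLp =
      ((I : ℝ) * J) • (fisherMatrix w t a).mulVec v.ofLp := by
  have hIJ : (I : ℝ) * J ≠ 0 := by positivity
  ext r
  simp only [infoOperator_apply, Matrix.mulVec, dotProduct, fisherMatrix_apply ht ha,
    Fin.sum_univ_two, Pi.smul_apply, smul_eq_mul, WithLp.ofLp_sum, Finset.sum_apply,
    PiLp.smul_apply]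
  rw [mul_add, ← mul_assoc, ← mul_assoc, ← mul_assoc, ← mul_assoc, mul_one_div_cancel hIJ, one_mul,
    one_mul, Finset.sum_mul, Finset.sum_mul, ← Finset.sum_add_distrib]
  refine Finset.sum_congr rfl fun i _ => ?_
  rw [Finset.sum_mul, Finset.sum_mul, ← Finset.sum_add_distrib]
  refine Finset.sum_congr rfl fun j _ => ?_
  rw [PiLp.inner_apply]
  simp [Fin.sum_univ_two]
  ring

lemma posDef_fisherMatrix (hI : 0 < I) (hJ : 0 < J) (ht : ∀ j, 0 < t j)
    (hw : ∃ i i', w i ≠ w i') (ha : a ∈ paramSpace) : (fisherMatrix w t a).PosDef := by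
  refine Matrix.PosDef.of_dotProduct_mulVec_pos ?_ fun v hv => ?_
  · ext r s
    simp [fisherMatrix_apply ht ha, mul_comm]
  have h := sum_infoWeight_sq_pos hJ ht hw ha (v := WithLp.toLp 2 v) (by simpa using hv)
  have h1 := inner_infoOperator (w := w) (t := t) (a := a) (WithLp.toLp 2 v) (WithLp.toLp 2 v)
  have h2 : inner ℝ (WithLp.toLp 2 v) (infoOperator w t a (WithLp.toLp 2 v)) =
      ((I : ℝ) * J) * (star v ⬝ᵥ (fisherMatrix w t a).mulVec v) := by
    rw [EuclideanSpace.inner_eq_star_dotProduct, infoOperator_eq_mulVec hI hJ ht ha]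
    simp
    ring
  simp_rw [← pow_two] at h1
  rw [← h1, h2] at h
  exact pos_of_mul_pos_right h (by positivity)

end PositiveDefinite

end OneShot

namespace OneShot

/-! ### Concavity of the log-likelihood in the log-hazard -/

section TangentInequalities

/-- The reciprocals are slopes of secants of `exp` from `0`, increasing by convexity. With `x = exp
s` the quotient is the derivative of `log (1 - exp (-exp s))`, which is thus concave. -/
lemma div_exp_sub_one_anti {x y : ℝ} (hx : 0 < x) (hxy : x ≤ y) :
    y / (Real.exp y - 1) ≤ x / (Real.exp x - 1) := by
  have hy := hx.trans_le hxy
  have h := convexOn_exp.secant_mono (Set.mem_univ 0) (Set.mem_univ x) (Set.mem_univ y) hx.ne'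
    hy.ne' hxy
  simp only [Real.exp_zero, sub_zero] at h
  have hx' : 0 < (Real.exp x - 1) / x := div_pos (sub_pos.2 (Real.one_lt_exp_iff.2 hx)) hx
  have h' := inv_anti₀ hx' h
  rwa [inv_div, inv_div] at h'

lemma one_sub_exp_neg_pos {x : ℝ} (hx : 0 < x) : 0 < 1 - Real.exp (-x) := by
  simpa using hx

lemma hasDerivAt_log_one_sub_exp_neg_exp (s : ℝ) :
    HasDerivAt (fun s => Real.log (1 - Real.exp (-Real.exp s)))
      (Real.exp s / (Real.exp (Real.exp s) - 1)) s := by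
  have h0 := (one_sub_exp_neg_pos (Real.exp_pos s)).ne'
  have h1 : Real.exp (Real.exp s) - 1 ≠ 0 := (sub_pos.2 (Real.one_lt_exp_iff.2 (Real.exp_pos s))).ne'
  refine ((((Real.hasDerivAt_exp s).fun_neg.exp).const_sub 1).log h0).congr_deriv ?_
  simp only [Real.exp_neg] at h0 ⊢
  field_simp

lemma concaveOn_log_one_sub_exp_neg_exp :
    ConcaveOn ℝ Set.univ (fun s => Real.log (1 - Real.exp (-Real.exp s))) := by
  refine Antitone.concaveOn_univ_of_deriv
    (fun s => (hasDerivAt_log_one_sub_exp_neg_exp s).differentiableAt) fun s s' hs => ?_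
  rw [(hasDerivAt_log_one_sub_exp_neg_exp s).deriv, (hasDerivAt_log_one_sub_exp_neg_exp s').deriv]
  exact div_exp_sub_one_anti (Real.exp_pos _) (Real.exp_le_exp.2 hs)

lemma _root_.ConcaveOn.le_add_mul_sub_of_hasDerivAt {f : ℝ → ℝ} {f' x : ℝ}
    (hf : ConcaveOn ℝ Set.univ f) (hd : HasDerivAt f f' x) (y : ℝ) :
    f y ≤ f x + f' * (y - x) := by
  rcases lt_trichotomy x y with h | rfl | h
  · have := hf.slope_le_of_hasDerivAt (Set.mem_univ x) (Set.mem_univ y) h hd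
    rw [slope_def_field, div_le_iff₀ (sub_pos.2 h)] at this
    linarith
  · simp
  · have := hf.le_slope_of_hasDerivAt (Set.mem_univ y) (Set.mem_univ x) h hd
    rw [slope_def_field, le_div_iff₀ (sub_pos.2 h)] at this
    linarith

/-- This is the tangent at `s = log x`. The slope `x / (exp x - 1)` is written as `x (1 / F - 1)` to
match the form of the score. -/
lemma log_one_sub_exp_neg_le {x y : ℝ} (hx : 0 < x) (hy : 0 < y) :
    Real.log (1 - Real.exp (-y)) ≤ Real.log (1 - Real.exp (-x)) +
      x * ((1 - Real.exp (-x))⁻¹ - 1) * (Real.log y - Real.log x) := by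
  have h := concaveOn_log_one_sub_exp_neg_exp.le_add_mul_sub_of_hasDerivAt
    (hasDerivAt_log_one_sub_exp_neg_exp (Real.log x)) (Real.log y)
  rw [Real.exp_log hx, Real.exp_log hy] at h
  refine h.trans_eq ?_
  have h0 := (one_sub_exp_neg_pos hx).ne'
  have h1 : Real.exp x - 1 ≠ 0 := (sub_pos.2 (Real.one_lt_exp_iff.2 hx)).ne'
  simp only [Real.exp_neg] at h0 ⊢
  field_simp
  ring

lemma mul_log_sub_log_lt {x y : ℝ} (hx : 0 < x) (hy : 0 < y) (hxy : x ≠ y) :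
    x * (Real.log y - Real.log x) < y - x := by
  have h := Real.log_lt_sub_one_of_pos (div_pos hy hx) (by rwa [Ne, div_eq_one_iff_eq hx.ne', eq_comm])
  rw [Real.log_div hy.ne' hx.ne'] at h
  calc x * (Real.log y - Real.log x) < x * (y / x - 1) := mul_lt_mul_of_pos_left h hx
    _ = y - x := by field_simp

/-- The Bernoulli log-likelihood with failure frequency `p` is strictly concave in the logarithm of
the cumulative hazard, hence lies below its tangents. -/
lemma bernoulliLogLik_lt {x y p : ℝ} (hx : 0 < x) (hy : 0 < y) (hxy : x ≠ y) (hp0 : 0 ≤ p)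
    (hp1 : p < 1) :
    p * Real.log (1 - Real.exp (-y)) - (1 - p) * y <
      p * Real.log (1 - Real.exp (-x)) - (1 - p) * x +
        x * (p * (1 - Real.exp (-x))⁻¹ - 1) * (Real.log y - Real.log x) := by
  have h1 := mul_le_mul_of_nonneg_left (log_one_sub_exp_neg_le hx hy) hp0
  -- Strictness comes from the survival term alone, so its weight `1 - p` has to be positive.
  have h2 := mul_lt_mul_of_pos_left (mul_log_sub_log_lt hx hy hxy) (sub_pos.2 hp1)
  linarith

end TangentInequalities

/-! ### Zeros of the score are unique global maximizers -/

section Score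

variable {I J : ℕ} {w : Fin I → ℝ} {t : Fin J → ℝ} {a₀ a b : Param} {p : Fin I → Fin J → ℝ}

/-- The log-likelihood, divided by `K`, as a function of the failure frequencies `p`. -/
noncomputable def meanLogLik (w : Fin I → ℝ) (t : Fin J → ℝ) (p : Fin I → Fin J → ℝ)
    (a : Param) : ℝ :=
  ∑ i, ∑ j, (p i j * Real.log (lifeCdf a (w i) (t j)) +
    (1 - p i j) * Real.log (1 - lifeCdf a (w i) (t j)))

/-- The score for the failure frequencies `p`, in the coordinates in which the gradients of the log
failure rates are those at the base point `a₀`. -/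
noncomputable def score (w : Fin I → ℝ) (t : Fin J → ℝ) (a₀ : Param) (p : Fin I → Fin J → ℝ)
    (a : Param) : Param :=
  ∑ i, ∑ j, (cumHazard a (w i) (t j) * (p i j * (lifeCdf a (w i) (t j))⁻¹ - 1)) •
    covariate a₀ (w i)

/-- The failure probabilities of the test conditions. -/
noncomputable def failProb (w : Fin I → ℝ) (t : Fin J → ℝ) (a : Param) : Fin I → Fin J → ℝ :=
  fun i j => lifeCdf a (w i) (t j)

lemma score_failProb (ht : ∀ j, 0 < t j) (ha : a ∈ paramSpace) :
    score w t a₀ (failProb w t a) a = 0 := by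
  refine Finset.sum_eq_zero fun i _ => Finset.sum_eq_zero fun j _ => ?_
  rw [failProb, mul_inv_cancel₀ (lifeCdf_pos ha (ht j)).ne', sub_self, mul_zero, zero_smul]

lemma log_cumHazard {w t : ℝ} (ha : a ∈ paramSpace) (ht : 0 < t) :
    Real.log (cumHazard a w t) = Real.log (a 0) + a 1 * w + Real.log t := by
  have ha' : a 0 ≠ 0 := ne_of_gt ha
  rw [cumHazard, failRate, Real.log_mul (mul_ne_zero ha' (Real.exp_ne_zero _)) ht.ne',
    Real.log_mul ha' (Real.exp_ne_zero _), Real.log_exp]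

/-- The logarithms of the cumulative hazards determine the parameter. -/
lemma exists_cumHazard_ne (hJ : 0 < J) (ht : ∀ j, 0 < t j) (hw : ∃ i i', w i ≠ w i')
    (ha : a ∈ paramSpace) (hb : b ∈ paramSpace) (hab : a ≠ b) :
    ∃ i j, cumHazard a (w i) (t j) ≠ cumHazard b (w i) (t j) := by
  by_contra! h
  have hlog (i) : Real.log (a 0) + a 1 * w i = Real.log (b 0) + b 1 * w i := by
    have := congrArg Real.log (h i ⟨0, hJ⟩)
    rw [log_cumHazard ha (ht _), log_cumHazard hb (ht _)] at this
    exact add_right_cancel this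
  obtain ⟨i, i', hii⟩ := hw
  have h1 : a 1 = b 1 := by
    have : (a 1 - b 1) * (w i - w i') = 0 := by linear_combination hlog i - hlog i'
    exact sub_eq_zero.1 ((mul_eq_zero.1 this).resolve_right (sub_ne_zero.2 hii))
  have h0 : a 0 = b 0 := by
    have := hlog i
    rw [h1] at this
    exact Real.log_injOn_pos ha hb (add_right_cancel this)
  exact hab (by ext r; fin_cases r; exacts [h0, h1])

/-- Sum the tangent inequalities over the conditions. As the log-hazards are affine in `(log α₀,
α₁)`, the linear terms add up to the score paired with the displacement, which is zero; one
condition with distinct hazards makes the sum strict. -/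
lemma meanLogLik_lt_of_score_eq_zero (hJ : 0 < J) (ht : ∀ j, 0 < t j) (hw : ∃ i i', w i ≠ w i')
    (ha₀ : a₀ ∈ paramSpace) (ha : a ∈ paramSpace) (hb : b ∈ paramSpace) (hab : a ≠ b)
    (hp0 : ∀ i j, 0 ≤ p i j) (hp1 : ∀ i j, p i j < 1) (hs : score w t a₀ p a = 0) :
    meanLogLik w t p b < meanLogLik w t p a := by
  have ha₀' : a₀ 0 ≠ 0 := ne_of_gt ha₀
  let g (i : Fin I) (j : Fin J) : ℝ :=
    cumHazard a (w i) (t j) * (p i j * (lifeCdf a (w i) (t j))⁻¹ - 1) *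
      (Real.log (cumHazard b (w i) (t j)) - Real.log (cumHazard a (w i) (t j)))
  have hg : ∑ i, ∑ j, g i j = 0 := by
    -- The displacement in `(log α₀, α₁)`, its first coordinate scaled by `a₀ 0` to cancel the `1 /
    -- a₀ 0` in `covariate a₀`.
    have h := congrArg (inner ℝ · (!₂[a₀ 0 * (Real.log (b 0) - Real.log (a 0)), b 1 - a 1] : Param))
      hs
    simp only [score, sum_inner, inner_smul_left, inner_zero_left, inner_covariate] at h
    rw [← h]
    refine Finset.sum_congr rfl fun i _ => Finset.sum_congr rfl fun j _ => ?_
    simp only [g]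
    rw [log_cumHazard ha (ht j), log_cumHazard hb (ht j)]
    simp
    field_simp
    left
    ring
  have hcell (c : Param) (i : Fin I) (j : Fin J) : p i j * Real.log (lifeCdf c (w i) (t j)) +
      (1 - p i j) * Real.log (1 - lifeCdf c (w i) (t j)) =
      p i j * Real.log (1 - Real.exp (-cumHazard c (w i) (t j))) -
        (1 - p i j) * cumHazard c (w i) (t j) := by
    rw [one_sub_lifeCdf, Real.log_exp, lifeCdf_eq]
    ring
  have hlt (i j) (h : cumHazard a (w i) (t j) ≠ cumHazard b (w i) (t j)) :
      p i j * Real.log (lifeCdf b (w i) (t j)) +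
        (1 - p i j) * Real.log (1 - lifeCdf b (w i) (t j)) <
      p i j * Real.log (lifeCdf a (w i) (t j)) +
        (1 - p i j) * Real.log (1 - lifeCdf a (w i) (t j)) + g i j := by
    rw [hcell, hcell]
    exact bernoulliLogLik_lt (cumHazard_pos ha (ht j)) (cumHazard_pos hb (ht j)) h (hp0 i j)
      (hp1 i j)
  have hle (i j) : p i j * Real.log (lifeCdf b (w i) (t j)) +
        (1 - p i j) * Real.log (1 - lifeCdf b (w i) (t j)) ≤
      p i j * Real.log (lifeCdf a (w i) (t j)) +
        (1 - p i j) * Real.log (1 - lifeCdf a (w i) (t j)) + g i j := by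
    by_cases h : cumHazard a (w i) (t j) = cumHazard b (w i) (t j)
    · refine le_of_eq ?_
      rw [hcell, hcell]
      simp [g, h]
    · exact (hlt i j h).le
  obtain ⟨i₀, j₀, hne⟩ := exists_cumHazard_ne hJ ht hw ha hb hab
  calc meanLogLik w t p b < ∑ i, ∑ j, (p i j * Real.log (lifeCdf a (w i) (t j)) +
        (1 - p i j) * Real.log (1 - lifeCdf a (w i) (t j)) + g i j) :=
      Finset.sum_lt_sum (fun i _ => Finset.sum_le_sum fun j _ => hle i j) ⟨i₀, Finset.mem_univ _,
        Finset.sum_lt_sum (fun j _ => hle i₀ j) ⟨j₀, Finset.mem_univ _, hlt i₀ j₀ hne⟩⟩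
    _ = meanLogLik w t p a := by
      simp only [Finset.sum_add_distrib (f := fun j => _ + _), Finset.sum_add_distrib, hg, add_zero,
        meanLogLik]

end Score

/-! ### Solving the score equation near the true probabilities -/

section ImplicitFunction

variable {I J : ℕ} {w : Fin I → ℝ} {t : Fin J → ℝ} {a : Param}

/-- The partial derivative of the score with respect to the failure frequencies. -/
noncomputable def scoreFreqDeriv (w : Fin I → ℝ) (t : Fin J → ℝ) (a : Param) :
    (Fin I → Fin J → ℝ) →L[ℝ] Param :=
  ∑ i, ∑ j, (cumHazard a (w i) (t j) * (lifeCdf a (w i) (t j))⁻¹) •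
    ((ContinuousLinearMap.proj j).comp
      (ContinuousLinearMap.proj (R := ℝ) (φ := fun _ : Fin I => Fin J → ℝ) i)).smulRight
        (covariate a (w i))

lemma scoreFreqDeriv_apply (q : Fin I → Fin J → ℝ) : scoreFreqDeriv w t a q = ∑ i, ∑ j,
    (cumHazard a (w i) (t j) * (lifeCdf a (w i) (t j))⁻¹ * q i j) • covariate a (w i) := by
  simp [scoreFreqDeriv, mul_smul]

/-- At the true probabilities `p / F - 1 = 0`, so the derivative of the hazard does not contribute.
Only `x F · d(1 / F)` remains in the parameter direction, with coefficient `-x² (1 - F) / F`. -/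
lemma hasStrictFDerivAt_score (ht : ∀ j, 0 < t j) (ha : a ∈ paramSpace) :
    HasStrictFDerivAt (fun x : (Fin I → Fin J → ℝ) × Param => score w t a x.1 x.2)
      ((scoreFreqDeriv w t a).coprod (-infoOperator w t a)) (failProb w t a, a) := by
  have hsnd : HasStrictFDerivAt (fun x : (Fin I → Fin J → ℝ) × Param => x.2)
    (.snd ℝ (Fin I → Fin J → ℝ) Param) (failProb w t a, a) := hasStrictFDerivAt_snd
  have hx (i : Fin I) (j : Fin J) := HasStrictFDerivAt.comp (f := Prod.snd) (failProb w t a, a)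
    (hasStrictFDerivAt_cumHazard (w := w i) (t := t j) ha) hsnd
  have hF (i : Fin I) (j : Fin J) := HasStrictFDerivAt.comp (f := Prod.snd) (failProb w t a, a)
    ((hasStrictDerivAt_inv (lifeCdf_pos (w := w i) ha (ht j)).ne').comp_hasStrictFDerivAt a
      (hasStrictFDerivAt_lifeCdf ha)) hsnd
  have hp (i : Fin I) (j : Fin J) := ((ContinuousLinearMap.proj (R := ℝ) (φ := fun _ => ℝ) j).comp
    (ContinuousLinearMap.proj (R := ℝ) (φ := fun _ : Fin I => Fin J → ℝ) i)).hasStrictFDerivAt.comp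
      (failProb w t a, a) hasStrictFDerivAt_fst
  refine (HasStrictFDerivAt.fun_sum fun i _ => HasStrictFDerivAt.fun_sum fun j _ =>
    ((hx i j).fun_mul (((hp i j).fun_mul (hF i j)).sub_const 1)).smul_const
      (covariate a (w i))).congr_fderiv ?_
  refine ContinuousLinearMap.ext fun ⟨q, v⟩ => ?_
  simp only [ContinuousLinearMap.coprod_apply, scoreFreqDeriv_apply, neg_apply,
    infoOperator_apply, ← sub_eq_add_neg, ← Finset.sum_sub_distrib, sum_apply]
  refine Finset.sum_congr rfl fun i _ => Finset.sum_congr rfl fun j _ => ?_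
  have h1 := (lifeCdf_pos (w := w i) ha (ht j)).ne'
  have h2 : failProb w t a i j = lifeCdf a (w i) (t j) := rfl
  simp only [infoWeight, smul_smul, ← sub_smul, ContinuousLinearMap.smulRight_apply]
  congr 1
  simp [h2]
  field_simp
  ring

lemma isInvertible_infoOperator (hJ : 0 < J) (ht : ∀ j, 0 < t j) (hw : ∃ i i', w i ≠ w i')
    (ha : a ∈ paramSpace) : (infoOperator w t a).IsInvertible := by
  have hinj : Function.Injective (infoOperator w t a : Param →ₗ[ℝ] Param) := by
    refine (injective_iff_map_eq_zero _).2 fun v hv => ?_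
    by_contra hv0
    have h := sum_infoWeight_sq_pos hJ ht hw ha hv0
    have h1 := inner_infoOperator (w := w) (t := t) (a := a) v v
    have hv' : infoOperator w t a v = 0 := hv
    simp_rw [← pow_two, hv', inner_zero_right] at h1
    exact h.ne h1
  exact ⟨(LinearEquiv.ofInjectiveEndo _ hinj).toContinuousLinearEquiv, rfl⟩

/-- The asymptotic linearization of the maximum likelihood estimate. -/
noncomputable def mleDeriv (w : Fin I → ℝ) (t : Fin J → ℝ) (a : Param) :
    (Fin I → Fin J → ℝ) →L[ℝ] Param :=
  (infoOperator w t a).inverse ∘L scoreFreqDeriv w t a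

/-- Near the true failure probabilities the score equation is solved by a differentiable function
of the failure frequencies. -/
lemma exists_score_solution (hJ : 0 < J) (ht : ∀ j, 0 < t j) (hw : ∃ i i', w i ≠ w i')
    (ha : a ∈ paramSpace) :
    ∃ φ : (Fin I → Fin J → ℝ) → Param, φ (failProb w t a) = a ∧
      HasFDerivAt φ (mleDeriv w t a) (failProb w t a) ∧
      ∀ᶠ p in 𝓝 (failProb w t a), score w t a p (φ p) = 0 := by
  -- After the change of sign the partial derivative in the parameter is `infoOperator` itself.
  have hd := (hasStrictFDerivAt_score (w := w) ht ha).neg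
  have hinv : ((-(scoreFreqDeriv w t a).coprod (-infoOperator w t a)) ∘L
      .inr ℝ (Fin I → Fin J → ℝ) Param).IsInvertible := by
    convert isInvertible_infoOperator hJ ht hw ha using 1
    ext v
    simp
  refine ⟨hd.implicitFunctionOfProdDomain hinv, ?_, ?_, ?_⟩
  · exact (hd.eventually_apply_eq_iff_implicitFunctionOfProdDomain hinv).self_of_nhds.1 rfl
  · refine (hd.hasStrictFDerivAt_implicitFunctionOfProdDomain hinv).hasFDerivAt.congr_fderiv ?_
    rw [mleDeriv]
    have h1 : (-(scoreFreqDeriv w t a).coprod (-infoOperator w t a)) ∘L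
      .inr ℝ (Fin I → Fin J → ℝ) Param = infoOperator w t a := by
      ext v
      simp
    have h2 : (-(scoreFreqDeriv w t a).coprod (-infoOperator w t a)) ∘L
      .inl ℝ (Fin I → Fin J → ℝ) Param = -scoreFreqDeriv w t a := by
      ext v
      simp
    rw [h1, h2]
    ext v
    simp
  -- The implicit function keeps the score at its value at the base point, which is zero.
  · filter_upwards [hd.eventually_apply_implicitFunctionOfProdDomain hinv] with p hp
    simpa [score_failProb ht ha] using hp

end ImplicitFunction

/-! ### The estimate as a function of the failure frequencies -/

section Estimate

variable {I J K : ℕ} {w : Fin I → ℝ} {t : Fin J → ℝ} {a b : Param}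

/-- The failure frequencies `n_{ij} / K`. -/
noncomputable def failFreq (y : Data I J K) : Fin I → Fin J → ℝ :=
  fun i j => (failures y i j : ℝ) / K

lemma log_likelihood_eq_meanLogLik (hK : 0 < K) (ht : ∀ j, 0 < t j) (ha : a ∈ paramSpace)
    (y : Data I J K) :
    Real.log (likelihood w t y a) = K * meanLogLik w t (failFreq y) a := by
  rw [log_likelihood ht ha, meanLogLik, Finset.mul_sum]
  refine Finset.sum_congr rfl fun i _ => ?_
  rw [Finset.mul_sum]
  refine Finset.sum_congr rfl fun j _ => ?_
  rw [failFreq]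
  field_simp

lemma isMLE_iff_eq_of_score_eq_zero (hJ : 0 < J) (hK : 0 < K) (ht : ∀ j, 0 < t j)
    (hw : ∃ i i', w i ≠ w i') {a₀ : Param} (ha₀ : a₀ ∈ paramSpace) (ha : a ∈ paramSpace)
    {y : Data I J K} (hy : ∀ i j, failFreq y i j < 1) (hs : score w t a₀ (failFreq y) a = 0) :
    IsMLE w t y b ↔ b = a := by
  have hlt (b) (hb : b ∈ paramSpace) (hab : a ≠ b) : likelihood w t y b < likelihood w t y a := by
    rw [← Real.log_lt_log_iff (likelihood_pos ht hb y) (likelihood_pos ht ha y),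
      log_likelihood_eq_meanLogLik hK ht hb, log_likelihood_eq_meanLogLik hK ht ha]
    refine mul_lt_mul_of_pos_left ?_ (by positivity)
    exact meanLogLik_lt_of_score_eq_zero hJ ht hw ha₀ ha hb hab
      (fun i j => div_nonneg (by positivity) (by positivity)) hy hs
  refine ⟨fun hb => ?_, ?_⟩
  · by_contra hab
    exact (hb.2 a ha).not_gt (hlt b hb.1 (Ne.symm hab))
  · rintro rfl
    refine ⟨ha, fun c hc => ?_⟩
    obtain rfl | hbc := eq_or_ne b c
    · exact le_rfl
    · exact (hlt c hc hbc).le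

/-- Near the true failure probabilities, the estimate exists, is unique, and is a differentiable
function of the failure frequencies. -/
lemma exists_estimate_function (hI : 0 < I) (hJ : 0 < J) (ht : ∀ j, 0 < t j)
    (hw : ∃ i i', w i ≠ w i') (ha : a ∈ paramSpace) :
    ∃ φ : (Fin I → Fin J → ℝ) → Param, φ (failProb w t a) = a ∧
      HasFDerivAt φ (mleDeriv w t a) (failProb w t a) ∧
      ∀ᶠ p in 𝓝 (failProb w t a), ∀ K : ℕ, 0 < K → ∀ y : Data I J K, failFreq y = p →
        ∀ b, IsMDPDE w t 0 y b ↔ b = φ p := by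
  obtain ⟨φ, h0, hd, hs⟩ := exists_score_solution hJ ht hw ha
  refine ⟨φ, h0, hd, ?_⟩
  have hmem : ∀ᶠ p in 𝓝 (failProb w t a), φ p ∈ paramSpace :=
    hd.continuousAt.eventually_mem (by rw [h0]; exact isOpen_paramSpace.mem_nhds ha)
  have hlt : ∀ᶠ p in 𝓝 (failProb w t a), ∀ i j, p i j < 1 := by
    refine eventually_all.2 fun i => eventually_all.2 fun j => ?_
    have hc : Continuous fun p : Fin I → Fin J → ℝ => p i j := by fun_prop
    exact hc.continuousAt.eventually_lt_const lifeCdf_lt_one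
  -- None of the three conditions involves `K`, so a single neighbourhood serves all sample sizes.
  filter_upwards [hs, hmem, hlt] with p h1 h2 h3 K hK y hy b
  subst hy
  rw [isMDPDE_zero_iff_isMLE hI hJ hK ht]
  exact isMLE_iff_eq_of_score_eq_zero hJ hK ht hw ha h2 h3 h1

end Estimate

end OneShot

/-! ### Central limit theorem, Chebyshev bound and delta method -/

lemma charFun_map_smul_const {Ω : Type*} [MeasurableSpace Ω] {P : Measure Ω} {E : Type*}
    [NormedAddCommGroup E] [InnerProductSpace ℝ E] [MeasurableSpace E] [BorelSpace E] {V : Ω → ℝ} (hV : AEMeasurable V P) (u s : E) :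
    charFun (P.map fun ω => V ω • u) s = charFun (P.map V) (inner ℝ u s) := by
  rw [charFun_apply, charFun_apply_real, integral_map hV (by fun_prop),
    integral_map (f := fun x : E => Complex.exp ((inner ℝ x s : ℝ) * Complex.I))
      (hV.smul_const u) (Continuous.aestronglyMeasurable (by fun_prop))]
  refine integral_congr_ae (ae_of_all _ fun ω => ?_)
  simp only [inner_smul_left]
  simp
  ring_nf

/-- A multivariate central limit theorem for finitely many independent sequences of independent and
identically distributed real random variables, each of which moves along a fixed vector. -/
theorem tendstoInDistribution_sum_smul {Ω : Type*} [MeasurableSpace Ω] {P : Measure Ω} [IsProbabilityMeasure P]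
    {ι E : Type*} [Fintype ι] [NormedAddCommGroup E]
    [InnerProductSpace ℝ E] [FiniteDimensional ℝ E] [MeasurableSpace E] [BorelSpace E]
    {X : ι → ℕ → Ω → ℝ} (hindep : iIndepFun (fun x : ι × ℕ => X x.1 x.2) P)
    (hident : ∀ m k, IdentDistrib (X m k) (X m 0) P P) (hX : ∀ m, MemLp (X m 0) 2 P)
    (u : ι → E) (ν : Measure E) [IsProbabilityMeasure ν]
    (hν : ∀ s, charFun ν s =
      ∏ m, charFun (gaussianReal 0 Var[X m 0; P].toNNReal) (inner ℝ (u m) s)) :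
    TendstoInDistribution (fun (n : ℕ) ω => ∑ m, ((√n)⁻¹ *
      (∑ k ∈ Finset.range n, X m k ω - n * P[X m 0])) • u m) atTop (id : E → E) (fun _ => P) ν where
  forall_aemeasurable n := by
    have h (m k) : AEMeasurable (X m k) P := (hident m k).aemeasurable_fst
    fun_prop
  aemeasurable_limit := aemeasurable_id
  tendsto := by
    have hm (m k) : AEMeasurable (X m k) P := (hident m k).aemeasurable_fst
    have hsum (n : ℕ) (m : ι) (ω : Ω) :
        (√(n : ℝ))⁻¹ * (∑ k ∈ Finset.range n, X m k ω - n * P[X m 0]) =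
          ∑ k ∈ Finset.range n, (√(n : ℝ))⁻¹ * (X m k ω - P[X m 0]) := by
      rw [← Finset.mul_sum, Finset.sum_sub_distrib]
      simp
    have hrow (m : ι) : iIndepFun (X m) P :=
      hindep.precomp (g := fun k : ℕ => (m, k)) fun k l h => (Prod.ext_iff.1 h).2
    refine ProbabilityMeasure.tendsto_iff_tendsto_charFun.2 fun s => ?_
    simp only [ProbabilityMeasure.coe_mk, Measure.map_id, hν]
    -- Along a fixed vector `u m` only the number `inner (u m) s` matters, so the real central limit
    -- theorem applies to each `m`.
    have hclt (m : ι) : Tendsto (fun n : ℕ => charFun (P.map fun ω => (√(n : ℝ))⁻¹ *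
        (∑ k ∈ Finset.range n, X m k ω - n * P[X m 0])) (inner ℝ (u m) s)) atTop
        (𝓝 (charFun (gaussianReal 0 Var[X m 0; P].toNNReal) (inner ℝ (u m) s))) := by
      have h := (tendstoInDistribution_inv_sqrt_mul_sum_sub (HasLaw.id) (hX m) (hrow m)
        (hident m)).tendsto
      simpa using ProbabilityMeasure.tendsto_iff_tendsto_charFun.1 h (inner ℝ (u m) s)
    refine (tendsto_finsetProd Finset.univ fun m _ => hclt m).congr fun n => ?_
    simp_rw [hsum n, Finset.sum_smul]
    have h1 (m : ι) : charFun (P.map fun ω => ∑ k ∈ Finset.range n,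
        (√(n : ℝ))⁻¹ * (X m k ω - P[X m 0])) (inner ℝ (u m) s) =
        ∏ k ∈ Finset.range n,
          charFun (P.map fun ω => ((√(n : ℝ))⁻¹ * (X m k ω - P[X m 0])) • u m) s := by
      have hi : iIndepFun (fun k ω => (√(n : ℝ))⁻¹ * (X m k ω - P[X m 0])) P :=
        (hrow m).comp (fun _ x => (√(n : ℝ))⁻¹ * (x - ∫ ω, X m 0 ω ∂P)) fun _ => by fun_prop
      rw [(hi.restrict _).charFun_map_fun_finsetSum_eq_prod fun k _ => by fun_prop,
        Finset.prod_apply]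
      refine Finset.prod_congr rfl fun k _ => ?_
      rw [charFun_map_smul_const (by fun_prop)]
    -- Joint independence over all pairs `(m, k)` factors the characteristic function of the double
    -- sum in one go.
    have h2 : charFun (P.map fun ω => ∑ m, ∑ k ∈ Finset.range n,
        ((√(n : ℝ))⁻¹ * (X m k ω - P[X m 0])) • u m) s =
        ∏ m, ∏ k ∈ Finset.range n,
          charFun (P.map fun ω => ((√(n : ℝ))⁻¹ * (X m k ω - P[X m 0])) • u m) s := by
      have hi : iIndepFun (fun (x : ι × ℕ) ω =>
          ((√(n : ℝ))⁻¹ * (X x.1 x.2 ω - P[X x.1 0])) • u x.1) P :=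
        hindep.comp (fun x y => ((√(n : ℝ))⁻¹ * (y - ∫ ω, X x.1 0 ω ∂P)) • u x.1) fun _ => by fun_prop
      simp_rw [← Finset.sum_product', ← Finset.prod_product']
      rw [(hi.restrict _).charFun_map_fun_finsetSum_eq_prod fun x _ => by fun_prop,
        Finset.prod_apply]
    rw [h2]
    exact Finset.prod_congr rfl fun m _ => h1 m

/-- Chebyshev's inequality for the mean of independent and identically distributed variables. -/
lemma meas_le_sqrt_mul_abs_mean_sub {Ω : Type*} [MeasurableSpace Ω] {P : Measure Ω} [IsProbabilityMeasure P]
    {X : ℕ → Ω → ℝ} (hindep : iIndepFun X P)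
    (hident : ∀ k, IdentDistrib (X k) (X 0) P P) (hX : MemLp (X 0) 2 P) {n : ℕ} (hn : 0 < n)
    {M : ℝ} (hM : 0 < M) :
    P {ω | M ≤ √(n : ℝ) * |(∑ k ∈ Finset.range n, X k ω) / n - P[X 0]|} ≤
      ENNReal.ofReal (Var[X 0; P] / M ^ 2) := by
  have hL (k) : MemLp (X k) 2 P := (hident k).symm.memLp_iff.1 hX
  have hmean : ∫ ω, (∑ k ∈ Finset.range n, X k) ω ∂P = n * ∫ ω, X 0 ω ∂P := by
    simp only [Finset.sum_apply]
    rw [integral_finsetSum _ fun k _ => (hL k).integrable one_le_two]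
    simp [fun k => (hident k).integral_eq]
  have hvar : Var[∑ k ∈ Finset.range n, X k; P] = n * Var[X 0; P] := by
    rw [IndepFun.variance_sum (fun k _ => hL k) fun k _ l _ hkl => hindep.indepFun hkl]
    simp [fun k => (hident k).variance_eq]
  have hn' : (0 : ℝ) < n := by exact_mod_cast hn
  have hs : 0 < √(n : ℝ) := Real.sqrt_pos.2 hn'
  have h := meas_ge_le_variance_div_sq (memLp_finsetSum' (Finset.range n) fun k _ => hL k)
    (mul_pos hs hM)
  rw [hmean, hvar, mul_pow, Real.sq_sqrt hn'.le, mul_div_mul_left _ _ hn'.ne'] at h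
  refine le_trans (measure_mono fun ω hω => ?_) h
  simp only [Set.mem_ofPred_eq, Finset.sum_apply] at hω ⊢
  have e : (∑ k ∈ Finset.range n, X k ω) / n - P[X 0] =
      (∑ k ∈ Finset.range n, X k ω - n * P[X 0]) / n := by
    field_simp
  rw [e, abs_div, abs_of_pos hn'] at hω
  calc √(n : ℝ) * M ≤ √(n : ℝ) * (√(n : ℝ) *
        (|∑ k ∈ Finset.range n, X k ω - n * P[X 0]| / n)) :=
      mul_le_mul_of_nonneg_left hω hs.le
    _ = |∑ k ∈ Finset.range n, X k ω - n * P[X 0]| := by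
      rw [← mul_assoc, Real.mul_self_sqrt hn'.le, mul_div_cancel₀ _ hn'.ne']

lemma exists_ofReal_div_sq_le (C : ℝ) {ε : ENNReal} (hε : 0 < ε) :
    ∃ M : ℝ, 0 < M ∧ ENNReal.ofReal (C / M ^ 2) ≤ ε := by
  have h : Tendsto (fun M : ℝ => ENNReal.ofReal (C / M ^ 2)) atTop (𝓝 0) := by
    have h0 : Tendsto (fun M : ℝ => C / M ^ 2) atTop (𝓝 0) :=
      (tendsto_pow_atTop two_ne_zero).const_div_atTop C
    simpa using ENNReal.tendsto_ofReal h0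
  obtain ⟨M, h1, h2⟩ := ((eventually_gt_atTop 0).and (h.eventually_le_const hε)).exists
  exact ⟨M, h1, h2⟩

lemma tendsto_meas_norm_sub_ge_of_chebyshev {Ω : Type*} [MeasurableSpace Ω] {P : Measure Ω}
    {E : Type*} [NormedAddCommGroup E] {q : ℕ → Ω → E} {q₀ : E} {C : ℝ}
    (hq : ∀ n : ℕ, 0 < n → ∀ M : ℝ, 0 < M →
      P {ω | M ≤ √(n : ℝ) * ‖q n ω - q₀‖} ≤ ENNReal.ofReal (C / M ^ 2)) {r : ℝ} (hr : 0 < r) :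
    Tendsto (fun n => P {ω | r ≤ ‖q n ω - q₀‖}) atTop (𝓝 0) := by
  refine ENNReal.tendsto_nhds_zero.2 fun ε hε => ?_
  obtain ⟨M, hM, hMε⟩ := exists_ofReal_div_sq_le C hε
  have hsqrt : Tendsto (fun n : ℕ => √(n : ℝ) * r) atTop atTop :=
    (Real.tendsto_sqrt_atTop.comp tendsto_natCast_atTop_atTop).atTop_mul_const hr
  filter_upwards [eventually_gt_atTop 0, hsqrt.eventually_ge_atTop M] with n hn hnM
  refine le_trans (measure_mono fun ω hω => ?_) ((hq n hn M hM).trans hMε)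
  exact hnM.trans (mul_le_mul_of_nonneg_left hω (Real.sqrt_nonneg _))

/-- The remainder in the delta method tends to zero in probability. -/
lemma tendstoInMeasure_delta_remainder {Ω : Type*} [MeasurableSpace Ω] {P : Measure Ω}
    {E F : Type*} [NormedAddCommGroup E] [NormedSpace ℝ E] [NormedAddCommGroup F] [NormedSpace ℝ F]
    {q : ℕ → Ω → E} {q₀ : E} {C : ℝ} {φ : E → F} {L : E →L[ℝ] F} (hφ : HasFDerivAt φ L q₀)
    (hq : ∀ n : ℕ, 0 < n → ∀ M : ℝ, 0 < M →
      P {ω | M ≤ √(n : ℝ) * ‖q n ω - q₀‖} ≤ ENNReal.ofReal (C / M ^ 2))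
    {U : Set E} (hU : U ∈ 𝓝 q₀) {est : ℕ → Ω → F}
    (hest : ∀ n : ℕ, 0 < n → ∀ᵐ ω ∂P, q n ω ∈ U → est n ω = φ (q n ω)) :
    TendstoInMeasure P (fun (n : ℕ) ω => √(n : ℝ) • (est n ω - φ q₀) -
      L (√(n : ℝ) • (q n ω - q₀))) atTop 0 := by
  rw [tendstoInMeasure_iff_norm]
  intro δ hδ
  refine ENNReal.tendsto_nhds_zero.2 fun ε hε => ?_
  obtain ⟨M, hM, hMε⟩ := exists_ofReal_div_sq_le C hε
  -- The slope `δ / (2 * M)` is chosen so that `√n ‖q - q₀‖ < M` bounds the scaled linearization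
  -- error by `δ / 2`.
  have hlin : ∀ᶠ p in 𝓝 q₀, ‖φ p - φ q₀ - L (p - q₀)‖ ≤ δ / (2 * M) * ‖p - q₀‖ :=
    hφ.isLittleO.def (by positivity)
  obtain ⟨r, hr, hball⟩ := Metric.mem_nhds_iff.1 (inter_mem hU hlin)
  have hsqrt : Tendsto (fun n : ℕ => √(n : ℝ) * r) atTop atTop :=
    (Real.tendsto_sqrt_atTop.comp tendsto_natCast_atTop_atTop).atTop_mul_const hr
  -- Once `M ≤ √n r`, the event `√n ‖q - q₀‖ < M` already places `q` in the ball.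
  filter_upwards [eventually_gt_atTop 0, hsqrt.eventually_ge_atTop M] with n hn hnM
  refine le_trans (measure_mono_ae ?_) ((hq n hn M hM).trans hMε)
  filter_upwards [hest n hn] with ω hω
  refine fun (hδω : δ ≤ _) => show M ≤ _ from ?_
  by_contra! hlt
  have hs : 0 < √(n : ℝ) := Real.sqrt_pos.2 (by exact_mod_cast hn)
  have hmem : q n ω ∈ Metric.ball q₀ r := by
    rw [mem_ball_iff_norm]
    exact lt_of_mul_lt_mul_left (hlt.trans_le hnM) hs.le
  obtain ⟨h1, h2⟩ := hball hmem
  have h2' : ‖φ (q n ω) - φ q₀ - L (q n ω - q₀)‖ ≤ δ / (2 * M) * ‖q n ω - q₀‖ := h2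
  rw [Pi.zero_apply, sub_zero, hω h1, map_smul, ← smul_sub, norm_smul, Real.norm_of_nonneg hs.le]
    at hδω
  have h3 : √(n : ℝ) * ‖φ (q n ω) - φ q₀ - L (q n ω - q₀)‖ ≤ δ / 2 := by
    calc _ ≤ √(n : ℝ) * (δ / (2 * M) * ‖q n ω - q₀‖) := mul_le_mul_of_nonneg_left h2' hs.le
      _ = δ / (2 * M) * (√(n : ℝ) * ‖q n ω - q₀‖) := by ring
      _ ≤ δ / (2 * M) * M := mul_le_mul_of_nonneg_left hlt.le (by positivity)
      _ = δ / 2 := by field_simp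
  linarith


namespace OneShot

/-! ### Identification of the limiting covariance -/

section Covariance

variable {I J : ℕ} {w : Fin I → ℝ} {t : Fin J → ℝ} {a : Param}

/-- The influence of the failure frequency of one test condition on the estimate. -/
noncomputable def influence (w : Fin I → ℝ) (t : Fin J → ℝ) (a : Param) (m : Fin I × Fin J) :
    Param :=
  (infoOperator w t a).inverse
    ((cumHazard a (w m.1) (t m.2) * (lifeCdf a (w m.1) (t m.2))⁻¹) • covariate a (w m.1))

lemma mleDeriv_apply (q : Fin I → Fin J → ℝ) :
    mleDeriv w t a q = ∑ m : Fin I × Fin J, q m.1 m.2 • influence w t a m := by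
  simp only [mleDeriv, ContinuousLinearMap.comp_apply, scoreFreqDeriv_apply, map_sum,
    Fintype.sum_prod_type, influence]
  refine Finset.sum_congr rfl fun i _ => Finset.sum_congr rfl fun j _ => ?_
  rw [← map_smul, smul_smul]
  congr 2
  ring

lemma inner_infoOperator_comm (u v : Param) :
    inner ℝ (infoOperator w t a u) v = inner ℝ u (infoOperator w t a v) := by
  rw [real_inner_comm, inner_infoOperator, inner_infoOperator]
  simp_rw [mul_comm (inner ℝ _ v)]

/-- With `A = infoOperator` self-adjoint and `z = A⁻¹ s`, the pairing with the influence is `(x / F)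
⟨covariate, z⟩`. Since `F (1 - F) (x / F)²` is `infoWeight`, the sum is `⟨z, A z⟩ = ⟨s, A⁻¹ s⟩`: the
sandwich collapses. -/
lemma sum_variance_mul_inner_influence_sq (hJ : 0 < J) (ht : ∀ j, 0 < t j)
    (hw : ∃ i i', w i ≠ w i') (ha : a ∈ paramSpace) (s : Param) :
    ∑ m : Fin I × Fin J, lifeCdf a (w m.1) (t m.2) * (1 - lifeCdf a (w m.1) (t m.2)) *
      inner ℝ (influence w t a m) s ^ 2 = inner ℝ s ((infoOperator w t a).inverse s) := by
  have hinv := isInvertible_infoOperator hJ ht hw ha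
  obtain ⟨z, hz⟩ : ∃ z, z = (infoOperator w t a).inverse s := ⟨_, rfl⟩
  have hs : infoOperator w t a z = s := by rw [hz, hinv.self_apply_inverse]
  rw [← hz]
  conv_rhs => rw [← hs, inner_infoOperator_comm, inner_infoOperator]
  rw [Fintype.sum_prod_type]
  refine Finset.sum_congr rfl fun i _ => Finset.sum_congr rfl fun j _ => ?_
  have h1 := (lifeCdf_pos (w := w i) ha (ht j)).ne'
  have h2 : inner ℝ (influence w t a (i, j)) s = cumHazard a (w i) (t j) *
      (lifeCdf a (w i) (t j))⁻¹ * inner ℝ (covariate a (w i)) z := by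
    rw [← hs, ← inner_infoOperator_comm, influence, hinv.self_apply_inverse, inner_smul_left]
    rfl
  rw [h2, infoWeight]
  field_simp

/-- The asymptotic covariance matrix. -/
noncomputable def asymptCov (w : Fin I → ℝ) (t : Fin J → ℝ) (a : Param) :
    Matrix (Fin 2) (Fin 2) ℝ :=
  (1 / ((I : ℝ) * J)) • (fisherMatrix w t a)⁻¹

lemma posSemidef_asymptCov (hI : 0 < I) (hJ : 0 < J) (ht : ∀ j, 0 < t j)
    (hw : ∃ i i', w i ≠ w i') (ha : a ∈ paramSpace) : (asymptCov w t a).PosSemidef :=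
  (posDef_fisherMatrix hI hJ ht hw ha).inv.posSemidef.smul (by positivity)

lemma infoOperator_inverse_eq_mulVec (hI : 0 < I) (hJ : 0 < J) (ht : ∀ j, 0 < t j)
    (hw : ∃ i i', w i ≠ w i') (ha : a ∈ paramSpace) (s : Param) :
    ((infoOperator w t a).inverse s).ofLp = (asymptCov w t a).mulVec s.ofLp := by
  have hinv := isInvertible_infoOperator hJ ht hw ha
  have hIJ : (I : ℝ) * J ≠ 0 := by positivity
  have hdet := (Matrix.isUnit_iff_isUnit_det _).1 (posDef_fisherMatrix hI hJ ht hw ha).isUnit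
  have h := infoOperator_eq_mulVec (w := w) hI hJ ht ha ((infoOperator w t a).inverse s)
  rw [hinv.self_apply_inverse] at h
  rw [h, asymptCov, Matrix.mulVec_smul, Matrix.smul_mulVec, smul_smul, mul_one_div_cancel hIJ,
    one_smul, Matrix.mulVec_mulVec, Matrix.nonsing_inv_mul _ hdet, Matrix.one_mulVec]

lemma charFun_multivariateGaussian_asymptCov (hI : 0 < I) (hJ : 0 < J) (ht : ∀ j, 0 < t j)
    (hw : ∃ i i', w i ≠ w i') (ha : a ∈ paramSpace) (s : Param) :
    charFun (multivariateGaussian 0 (asymptCov w t a)) s = ∏ m : Fin I × Fin J,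
      charFun (gaussianReal 0
        (lifeCdf a (w m.1) (t m.2) * (1 - lifeCdf a (w m.1) (t m.2))).toNNReal)
          (inner ℝ (influence w t a m) s) := by
  have h : s.ofLp ⬝ᵥ (asymptCov w t a).mulVec s.ofLp =
      ∑ m : Fin I × Fin J, lifeCdf a (w m.1) (t m.2) * (1 - lifeCdf a (w m.1) (t m.2)) *
        inner ℝ (influence w t a m) s ^ 2 := by
    rw [sum_variance_mul_inner_influence_sq hJ ht hw ha,
      ← infoOperator_inverse_eq_mulVec hI hJ ht hw ha, EuclideanSpace.inner_eq_star_dotProduct,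
      dotProduct_comm]
    rfl
  rw [charFun_multivariateGaussian (posSemidef_asymptCov hI hJ ht hw ha), h]
  simp_rw [charFun_gaussianReal]
  rw [← Complex.exp_sum]
  congr 1
  have hv (m : Fin I × Fin J) :
      ((lifeCdf a (w m.1) (t m.2) * (1 - lifeCdf a (w m.1) (t m.2))).toNNReal : ℝ) =
        lifeCdf a (w m.1) (t m.2) * (1 - lifeCdf a (w m.1) (t m.2)) :=
    Real.coe_toNNReal _ (mul_pos (lifeCdf_pos ha (ht _)) one_sub_lifeCdf_pos).le
  have hv' (m : Fin I × Fin J) :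
      ((lifeCdf a (w m.1) (t m.2) * (1 - lifeCdf a (w m.1) (t m.2))).toNNReal : ℂ) =
        ((lifeCdf a (w m.1) (t m.2) * (1 - lifeCdf a (w m.1) (t m.2)) : ℝ) : ℂ) :=
    congrArg Complex.ofReal (hv m)
  simp only [hv', inner_zero_right]
  push_cast
  simp [Finset.sum_div]

end Covariance

/-! ### Existence with high probability and asymptotic normality -/

section Asymptotics

variable {I J : ℕ} {w : Fin I → ℝ} {t : Fin J → ℝ} {a : Param}
  {Ω : Type*} [MeasurableSpace Ω] {P : Measure Ω} {Y : Fin I → Fin J → ℕ → Ω → Bool}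

lemma integral_comp_of_hasLaw_obsLaw {w t : ℝ} {Z : Ω → Bool} (hZ : HasLaw Z (obsLaw a w t) P)
    (ha : a ∈ paramSpace) (ht : 0 < t) (f : Bool → ℝ) :
    ∫ ω, f (Z ω) ∂P = lifeCdf a w t * f true + (1 - lifeCdf a w t) * f false := by
  rw [← integral_obsLaw ha ht, ← hZ.map_eq,
    integral_map hZ.aemeasurable (measurable_of_countable f).aestronglyMeasurable]

lemma integral_toNat_of_hasLaw_obsLaw {w t : ℝ} {Z : Ω → Bool} (hZ : HasLaw Z (obsLaw a w t) P)
    (ha : a ∈ paramSpace) (ht : 0 < t) : ∫ ω, ((Z ω).toNat : ℝ) ∂P = lifeCdf a w t := by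
  rw [integral_comp_of_hasLaw_obsLaw hZ ha ht fun b => (b.toNat : ℝ)]
  simp

lemma aemeasurable_toNat_of_hasLaw_obsLaw {w t : ℝ} {Z : Ω → Bool}
    (hZ : HasLaw Z (obsLaw a w t) P) : AEMeasurable (fun ω => ((Z ω).toNat : ℝ)) P :=
  (measurable_of_countable fun b : Bool => (b.toNat : ℝ)).comp_aemeasurable hZ.aemeasurable

lemma variance_toNat_of_hasLaw_obsLaw {w t : ℝ} {Z : Ω → Bool} (hZ : HasLaw Z (obsLaw a w t) P)
    (ha : a ∈ paramSpace) (ht : 0 < t) :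
    Var[fun ω => ((Z ω).toNat : ℝ); P] = lifeCdf a w t * (1 - lifeCdf a w t) := by
  rw [variance_eq_integral (aemeasurable_toNat_of_hasLaw_obsLaw hZ),
    integral_toNat_of_hasLaw_obsLaw hZ ha ht,
    integral_comp_of_hasLaw_obsLaw hZ ha ht fun b => ((b.toNat : ℝ) - lifeCdf a w t) ^ 2]
  simp
  ring

lemma identDistrib_toNat_of_hasLaw_obsLaw {w t : ℝ} {Z Z' : Ω → Bool}
    (hZ : HasLaw Z (obsLaw a w t) P) (hZ' : HasLaw Z' (obsLaw a w t) P) :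
    IdentDistrib (fun ω => ((Z ω).toNat : ℝ)) (fun ω => ((Z' ω).toNat : ℝ)) P P :=
  IdentDistrib.comp (f := Z) (g := Z')
    ⟨hZ.aemeasurable, hZ'.aemeasurable, hZ.map_eq.trans hZ'.map_eq.symm⟩
    (measurable_of_countable fun b : Bool => (b.toNat : ℝ))

lemma memLp_toNat_of_hasLaw_obsLaw [IsProbabilityMeasure P] {w t : ℝ} {Z : Ω → Bool}
    (hZ : HasLaw Z (obsLaw a w t) P) : MemLp (fun ω => ((Z ω).toNat : ℝ)) 2 P :=
  MemLp.of_bound (aemeasurable_toNat_of_hasLaw_obsLaw hZ).aestronglyMeasurable 1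
    (ae_of_all _ fun ω => by cases Z ω <;> simp)

lemma failFreq_eq_sum_range {Ω : Type*} (Y : Fin I → Fin J → ℕ → Ω → Bool) (K : ℕ) (ω : Ω) (i : Fin I) (j : Fin J) :
    failFreq (fun i j (k : Fin K) => Y i j k ω) i j =
      (∑ k ∈ Finset.range K, ((Y i j k ω).toNat : ℝ)) / K := by
  rw [failFreq, failures, Nat.cast_sum, Fin.sum_univ_eq_sum_range fun k => ((Y i j k ω).toNat : ℝ)]

variable [IsProbabilityMeasure P]

/-- The norm is a supremum over the conditions, so a union bound adds the cellwise Chebyshev bounds.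
-/
lemma meas_le_sqrt_mul_norm_failFreq_sub (ht : ∀ j, 0 < t j) (ha : a ∈ paramSpace)
    (hlaw : ∀ i j k, HasLaw (Y i j k) (obsLaw a (w i) (t j)) P)
    (hindep : iIndepFun (fun x : Fin I × Fin J × ℕ => Y x.1 x.2.1 x.2.2) P)
    (K : ℕ) (hK : 0 < K) (M : ℝ) (hM : 0 < M) :
    P {ω | M ≤ √(K : ℝ) * ‖failFreq (fun i j (k : Fin K) => Y i j k ω) - failProb w t a‖} ≤
      ENNReal.ofReal ((∑ m : Fin I × Fin J,
        lifeCdf a (w m.1) (t m.2) * (1 - lifeCdf a (w m.1) (t m.2))) / M ^ 2) := by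
  have hcell (m : Fin I × Fin J) :
      P {ω | M ≤ √(K : ℝ) * |failFreq (fun i j (k : Fin K) => Y i j k ω) m.1 m.2 -
        failProb w t a m.1 m.2|} ≤ ENNReal.ofReal
          (lifeCdf a (w m.1) (t m.2) * (1 - lifeCdf a (w m.1) (t m.2)) / M ^ 2) := by
    have hi : iIndepFun (fun k ω => ((Y m.1 m.2 k ω).toNat : ℝ)) P :=
      (hindep.precomp (g := fun k : ℕ => (m.1, m.2, k)) fun k l h => by simpa using h).comp
        (fun _ b => (b.toNat : ℝ)) fun _ => measurable_of_countable _
    have h := meas_le_sqrt_mul_abs_mean_sub hi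
      (fun k => identDistrib_toNat_of_hasLaw_obsLaw (hlaw m.1 m.2 k) (hlaw m.1 m.2 0))
      (memLp_toNat_of_hasLaw_obsLaw (hlaw m.1 m.2 0)) hK hM
    rw [variance_toNat_of_hasLaw_obsLaw (hlaw m.1 m.2 0) ha (ht m.2),
      integral_toNat_of_hasLaw_obsLaw (hlaw m.1 m.2 0) ha (ht m.2)] at h
    simpa only [failFreq_eq_sum_range, failProb] using h
  rw [Finset.sum_div, ENNReal.ofReal_sum_of_nonneg fun m _ => div_nonneg
    (mul_pos (lifeCdf_pos ha (ht _)) one_sub_lifeCdf_pos).le (sq_nonneg M)]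
  refine le_trans (le_trans (measure_mono fun ω hω => ?_) (measure_iUnion_fintype_le P _))
    (Finset.sum_le_sum fun m _ => hcell m)
  have hs : 0 < √(K : ℝ) := Real.sqrt_pos.2 (by exact_mod_cast hK)
  simp only [Set.mem_iUnion, Set.mem_ofPred_eq] at hω ⊢
  by_contra! hlt
  refine hω.not_gt ?_
  have hnorm : ‖failFreq (fun i j (k : Fin K) => Y i j k ω) - failProb w t a‖ < M / √(K : ℝ) := by
    refine (pi_norm_lt_iff (by positivity)).2 fun i => (pi_norm_lt_iff (by positivity)).2 fun j => ?_
    rw [lt_div_iff₀' hs]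
    exact hlt (i, j)
  rwa [lt_div_iff₀' hs] at hnorm

lemma tendsto_measure_exists_isMDPDE (hI : 0 < I) (hJ : 0 < J) (ht : ∀ j, 0 < t j)
    (hw : ∃ i i', w i ≠ w i') (ha : a ∈ paramSpace)
    (hlaw : ∀ i j k, HasLaw (Y i j k) (obsLaw a (w i) (t j)) P)
    (hindep : iIndepFun (fun x : Fin I × Fin J × ℕ => Y x.1 x.2.1 x.2.2) P) :
    Tendsto (fun K : ℕ => P {ω | ∃ b, IsMDPDE w t 0 (fun i j (k : Fin K) => Y i j k ω) b}) atTop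
      (𝓝 1) := by
  obtain ⟨φ, -, -, hφ⟩ := exists_estimate_function hI hJ ht hw ha
  obtain ⟨r, hr, hball⟩ := Metric.eventually_nhds_iff_ball.1 hφ
  have h := tendsto_meas_norm_sub_ge_of_chebyshev
    (q := fun K ω => failFreq fun i j (k : Fin K) => Y i j k ω)
    (meas_le_sqrt_mul_norm_failFreq_sub ht ha hlaw hindep) hr
  have h1 : Tendsto (fun K : ℕ => 1 - P {ω | r ≤
      ‖failFreq (fun i j (k : Fin K) => Y i j k ω) - failProb w t a‖}) atTop (𝓝 1) := by
    simpa using ENNReal.Tendsto.sub tendsto_const_nhds h (Or.inl ENNReal.one_ne_top)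
  refine tendsto_of_tendsto_of_tendsto_of_le_of_le' h1 tendsto_const_nhds ?_
    (Eventually.of_forall fun K => prob_le_one)
  filter_upwards [eventually_gt_atTop 0] with K hK
  -- Subadditivity replaces passing to complements, so the existence event need not be measurable.
  rw [tsub_le_iff_right, ← measure_univ (μ := P)]
  refine le_trans (measure_mono fun ω _ => ?_) (measure_union_le _ _)
  obtain hω | hω := le_or_gt r
    ‖failFreq (fun i j (k : Fin K) => Y i j k ω) - failProb w t a‖
  · exact Or.inr hω
  · exact Or.inl ⟨_, (hball _ (mem_ball_iff_norm.2 hω) K hK _ rfl _).2 rfl⟩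

lemma tendstoInDistribution_mleDeriv (hI : 0 < I) (hJ : 0 < J) (ht : ∀ j, 0 < t j)
    (hw : ∃ i i', w i ≠ w i') (ha : a ∈ paramSpace)
    (hlaw : ∀ i j k, HasLaw (Y i j k) (obsLaw a (w i) (t j)) P)
    (hindep : iIndepFun (fun x : Fin I × Fin J × ℕ => Y x.1 x.2.1 x.2.2) P) :
    TendstoInDistribution (fun (K : ℕ) ω => mleDeriv w t a
      (√(K : ℝ) • (failFreq (fun i j (k : Fin K) => Y i j k ω) - failProb w t a))) atTop
      (id : Param → Param) (fun _ => P) (multivariateGaussian 0 (asymptCov w t a)) := by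
  have hi : iIndepFun (fun (x : (Fin I × Fin J) × ℕ) ω => ((Y x.1.1 x.1.2 x.2 ω).toNat : ℝ)) P :=
    (hindep.precomp (g := fun x : (Fin I × Fin J) × ℕ => (x.1.1, x.1.2, x.2))
      (Equiv.prodAssoc (Fin I) (Fin J) ℕ).injective).comp
        (fun _ b => (b.toNat : ℝ)) fun _ => measurable_of_countable _
  have h := tendstoInDistribution_sum_smul
    (X := fun (m : Fin I × Fin J) k ω => ((Y m.1 m.2 k ω).toNat : ℝ)) hi
    (fun m k => identDistrib_toNat_of_hasLaw_obsLaw (hlaw m.1 m.2 k) (hlaw m.1 m.2 0))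
    (fun m => memLp_toNat_of_hasLaw_obsLaw (hlaw m.1 m.2 0)) (influence w t a)
    (multivariateGaussian 0 (asymptCov w t a)) fun s => by
      simp_rw [fun m : Fin I × Fin J =>
        variance_toNat_of_hasLaw_obsLaw (hlaw m.1 m.2 0) ha (ht m.2)]
      exact charFun_multivariateGaussian_asymptCov hI hJ ht hw ha s
  refine h.congr (fun K => ae_of_all _ fun ω => ?_) .rfl
  simp only
  rw [mleDeriv_apply]
  refine Finset.sum_congr rfl fun m _ => ?_
  congr 1
  rw [integral_toNat_of_hasLaw_obsLaw (hlaw m.1 m.2 0) ha (ht m.2)]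
  simp only [Pi.smul_apply, Pi.sub_apply, failFreq_eq_sum_range, failProb, smul_eq_mul]
  -- For `K = 0` both sides vanish, as `√0` and its inverse are `0`.
  obtain rfl | hK := K.eq_zero_or_pos
  · simp
  · have hs : √(K : ℝ) ≠ 0 := (Real.sqrt_pos.2 (by exact_mod_cast hK)).ne'
    have hss : √(K : ℝ) ^ 2 = K := Real.sq_sqrt (Nat.cast_nonneg K)
    field_simp
    rw [hss]

lemma tendstoInDistribution_estimate (hI : 0 < I) (hJ : 0 < J) (ht : ∀ j, 0 < t j)
    (hw : ∃ i i', w i ≠ w i') (ha : a ∈ paramSpace)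
    (hlaw : ∀ i j k, HasLaw (Y i j k) (obsLaw a (w i) (t j)) P)
    (hindep : iIndepFun (fun x : Fin I × Fin J × ℕ => Y x.1 x.2.1 x.2.2) P)
    {est : ℕ → Ω → Param} (hmeas : ∀ K, AEMeasurable (est K) P)
    (hest : ∀ K, 0 < K → ∀ᵐ ω ∂P,
      (∃ b, IsMDPDE w t 0 (fun i j (k : Fin K) => Y i j k ω) b) →
        IsMDPDE w t 0 (fun i j (k : Fin K) => Y i j k ω) (est K ω)) :
    TendstoInDistribution (fun (K : ℕ) ω => √(K : ℝ) • (est K ω - a)) atTop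
      (id : Param → Param) (fun _ => P) (multivariateGaussian 0 (asymptCov w t a)) := by
  obtain ⟨φ, h0, hd, hφ⟩ := exists_estimate_function hI hJ ht hw ha
  -- Slutsky: the scaled estimate differs from its linearization by a term that tends to zero in
  -- probability.
  refine tendstoInDistribution_of_tendstoInMeasure_sub _ _
    (tendstoInDistribution_mleDeriv hI hJ ht hw ha hlaw hindep) ?_
    fun K => ((hmeas K).sub_const a).fun_const_smul _
  have h := tendstoInMeasure_delta_remainder (est := est) hd
    (q := fun K ω => failFreq fun i j (k : Fin K) => Y i j k ω)
    (meas_le_sqrt_mul_norm_failFreq_sub ht ha hlaw hindep) hφ fun K hK => by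
      filter_upwards [hest K hK] with ω hω hmem
      have hiff := hmem K hK _ rfl
      -- On the neighbourhood `φ` supplies an estimate, so `est` is one almost surely, and
      -- uniqueness identifies the two.
      exact (hiff _).1 (hω ⟨_, (hiff _).2 rfl⟩)
  rw [h0] at h
  exact h

end Asymptotics

end OneShot

theorem theorem7 {I J : ℕ} (hI : 0 < I) (hJ : 0 < J)
    (w : Fin I → ℝ) (t : Fin J → ℝ)
    (hw : ∀ i, 0 < w i) (ht : ∀ j, 0 < t j) :
    -- the divergence with tuning parameter 0 is the Kullback-Leibler divergence, as a limit
    (∀ (K : ℕ), 0 < K → ∀ (y : OneShot.Data I J K), ∀ a ∈ OneShot.paramSpace,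
      Tendsto (fun β => OneShot.dpd β (OneShot.obsProb y) (OneShot.modelProb w t a)) (𝓝[>] 0)
        (𝓝 (OneShot.dpd 0 (OneShot.obsProb y) (OneShot.modelProb w t a))) ∧
      OneShot.dpd 0 (OneShot.obsProb y) (OneShot.modelProb w t a) =
        OneShot.klVec (OneShot.obsProb y) (OneShot.modelProb w t a)) ∧
    -- the average loss, shifted by a constant, tends to minus the normalized log-likelihood
    (∀ (K : ℕ), 0 < K → ∀ (y : OneShot.Data I J K), ∀ a ∈ OneShot.paramSpace,
      Tendsto (fun β => OneShot.meanLoss w t β y a + 1 / β) (𝓝[>] 0)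
        (𝓝 (-(1 / ((I : ℝ) * J * K) * Real.log (OneShot.likelihood w t y a))))) ∧
    -- for tuning parameter 0 the estimator is the maximum likelihood estimator
    (∀ (K : ℕ), 0 < K → ∀ (y : OneShot.Data I J K) (a : OneShot.Param),
      OneShot.IsMDPDE w t 0 y a ↔ OneShot.IsMLE w t y a) ∧
    -- the explicit matrix is the Fisher information matrix
    (∀ (K : ℕ), 0 < K → ∀ a ∈ OneShot.paramSpace,
      OneShot.fisherInfo w t K a = OneShot.fisherMatrix w t a) ∧
    -- if two temperatures differ, it is invertible (positive definite)
    ((∃ i i', w i ≠ w i') →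
      ∀ a ∈ OneShot.paramSpace, (OneShot.fisherMatrix w t a).PosDef) ∧
    -- if two temperatures differ: existence of the estimate and asymptotic distribution
    ((∃ i i', w i ≠ w i') →
      ∀ {Ω : Type*} [MeasurableSpace Ω] (P : Measure Ω) [IsProbabilityMeasure P]
      (a₀ : OneShot.Param), a₀ ∈ OneShot.paramSpace →
      ∀ Y : Fin I → Fin J → ℕ → Ω → Bool,
      (∀ i j k, HasLaw (Y i j k) (OneShot.obsLaw a₀ (w i) (t j)) P) →
      iIndepFun (fun x : Fin I × Fin J × ℕ => Y x.1 x.2.1 x.2.2) P →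
      Tendsto (fun K : ℕ => P {ω | ∃ a, OneShot.IsMDPDE w t 0
          (fun i j (k : Fin K) => Y i j k ω) a}) atTop (𝓝 1) ∧
      ∀ est : ℕ → Ω → OneShot.Param,
      (∀ K, AEMeasurable (est K) P) →
      (∀ K, 0 < K → ∀ᵐ ω ∂P,
        (∃ a, OneShot.IsMDPDE w t 0 (fun i j (k : Fin K) => Y i j k ω) a) →
          OneShot.IsMDPDE w t 0 (fun i j (k : Fin K) => Y i j k ω) (est K ω)) →
      TendstoInDistribution (fun (K : ℕ) ω => √(K : ℝ) • (est K ω - a₀)) atTop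
        (id : OneShot.Param → OneShot.Param) (fun _ => P)
        (multivariateGaussian 0
          ((1 / ((I : ℝ) * J)) • (OneShot.fisherMatrix w t a₀)⁻¹))) ∧
    -- the matrices of the general theory reduce to the Fisher information matrix
    (∀ a ∈ OneShot.paramSpace,
      OneShot.matJ w t 0 a = OneShot.matK w t 0 a ∧
      OneShot.matK w t 0 a = OneShot.fisherMatrix w t a) := by
  refine ⟨fun K hK y a ha => ?_, fun K hK y a ha => OneShot.tendsto_meanLoss hI hJ hK ht ha y,
    fun K hK y a => OneShot.isMDPDE_zero_iff_isMLE hI hJ hK ht y,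
    fun K hK a ha => OneShot.fisherInfo_eq_fisherMatrix hK ht ha,
    fun hww a ha => OneShot.posDef_fisherMatrix hI hJ ht hww ha,
    fun hww Ω _ P _ a₀ ha₀ Y hlaw hindep =>
      ⟨OneShot.tendsto_measure_exists_isMDPDE hI hJ ht hww ha₀ hlaw hindep, fun est hmeas hest =>
        OneShot.tendstoInDistribution_estimate hI hJ ht hww ha₀ hlaw hindep hmeas hest⟩,
    fun a ha => ⟨(OneShot.matK_zero ht ha).symm,
      (OneShot.matK_zero ht ha).trans (OneShot.matJ_zero ht ha)⟩⟩
  have hp := OneShot.obsProb_nonneg y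
  have hq := OneShot.modelProb_pos (w := w) hI hJ ht ha
  have hpq := (OneShot.sum_obsProb hI hJ hK y).trans (OneShot.sum_modelProb hI hJ w t a).symm
  exact ⟨OneShot.tendsto_dpd hp hq hpq, OneShot.dpd_zero_eq_klVec hp hq hpq⟩
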